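/- Let $\mathbb F_q$ be a finite field, let $\epsilon\in\mathbb F_q$ be a fixed non-square (so $q$ is odd), and let $l\ge 1$. Index the standard basis of $\mathbb F_q^{2l}$ by $1,-1,2,\dots,l,-2,\dots,-l$, write $e_{a,b}$ for the matrix units, and put $$\beta=\begin{pmatrix}\beta_0&0&0\\0&0&I_{l-1}\\0&I_{l-1}&0\end{pmatrix},\quad \beta_0=\begin{pmatrix}1&0\\0&\epsilon\end{pmatrix},\qquad \mathrm O^-(2l,q)=\{g\in \mathrm{GL}(2l,q)\mid {}^Tg\beta g=\beta\}.$$ For $u$ with $\beta(u,u)\ne0$ let $\rho_u(v)=v-2\frac{\beta(u,v)}{\beta(u,u)}u$. The spinor norm of $g=\rho_{u_1}\cdots\rho_{u_k}$ is the coset $\Theta(g)=\prod_i\tfrac12\beta(u_i,u_i)\cdot\mathbb F_q^{\times2}$; such a factorization of $g$ exists, and the coset does not depend on it. The elementary matrices are, for $r\in\mathbb F_q$ and $i,j\in\{2,\dots,l\}$, $$\begin{aligned} x_{i,j}(r)&=I+r(e_{i,j}-e_{-j,-i})\quad(i\ne j),\\ x_{i,-j}(r)&=I+r(e_{i,-j}-e_{j,-i})\quad(i<j),\\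 x_{-i,j}(r)&=I+r(e_{-i,j}-e_{-j,i})\quad(i<j),\\ x_{i,1}(r)&=I+r(e_{1,i}-e_{-i,1})-\tfrac{r^2}2e_{-i,i},\\ x_{1,i}(r)&=I+r(e_{i,1}-e_{1,-i})-\tfrac{r^2}2e_{i,-i},\\ x_{i,-1}(r)&=I+r(e_{-1,i}-\epsilon e_{-i,-1})-\tfrac{\epsilon r^2}2e_{-i,i},\\ x_{-1,i}(r)&=I+r(\epsilon e_{i,-1}-e_{-1,-i})-\tfrac{\epsilon r^2}2e_{i,-i},\\ w_i&=I-e_{i,i}-e_{-i,-i}-e_{i,-i}-e_{-i,i}. \end{aligned}$$ An output of Gaussian elimination on $g$ is a block diagonal matrix $$\mathrm{diag}\bigl(A_0,\;\mathrm{diag}(1,\dots,1,\lambda),\;\mathrm{diag}(1,\dots,1,\lambda^{-1})\bigr),\qquad A_0\in M_2(\mathbb F_q),\ \lambda\in\mathbb F_q^\times$$ (with $\lambda=1$ if $l=1$) obtained from $g$ by finitely many multiplications, on the left or on the right, by elementary matrices. Let $N$ be the number of these multiplications in which the factor is one of the $w_i$. Let $g\in\mathrm O^-(2l,q)$. Then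 Gaussian elimination on $g$ has an output. For every output, obtained with $N$ uses of the $w_i$, we have $\det g=\pm1$, and there are $t,s\in\mathbb F_q$ with $t^2+\epsilon s^2=1$ such that the following holds. * If $\det g=(-1)^{N+1}$, then $A_0=\begin{pmatrix}t&\epsilon s\\s&-t\end{pmatrix}$, and $\Theta(g)=\lambda(1-t)\,\mathbb F_q^{\times2}$ when $t\ne1$, while $\Theta(g)=2\epsilon\lambda\,\mathbb F_q^{\times2}$ when $t=1$. * If $\det g=(-1)^{N}$, then $A_0=\begin{pmatrix}t&-\epsilon s\\s&t\end{pmatrix}$, and $\Theta(g)=2\epsilon\lambda(1-t)\,\mathbb F_q^{\times2}$ when $t\ne1$, while $\Theta(g)=\lambda\,\mathbb F_q^{\times2}$ when $t=1$. -/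

import Mathlib

open Matrix

section SpinorNorm

variable {F : Type*} [Field F] {n : Type*} [Fintype n] [DecidableEq n]

/-- The value `β(u, v) = ᵗu B v` of the bilinear form with matrix `B`. -/
def formVal (B : Matrix n n F) (u v : n → F) : F := u ⬝ᵥ (B *ᵥ v)

/-- The matrix of the reflection `ρ_u(v) = v - 2 (β(u,v) / β(u,u)) u`. -/
def reflectionMatrix (B : Matrix n n F) (u : n → F) : Matrix n n F :=
  1 - (2 / formVal B u u) • vecMulVec u (u ᵥ* B)

/-- The coset `c F^{×2}`, as a set of elements of `F`. -/
def sqCoset (c : F) : Set F := {y | ∃ x : F, x ≠ 0 ∧ y = c * x ^ 2}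

/-- The spinor norm of `g` with respect to the form with matrix `B`, a coset of `F^{×2}` in `F^×`:
the set of all scalars lying in a coset `(∏ β(uᵢ,uᵢ)/2) F^{×2}`, where `g = ρ_{u₁} ⋯ ρ_{u_k}` is a
factorization of `g` into reflections in anisotropic vectors.

All factorizations contribute to the set. Hence, for `c ≠ 0`, the equation
`spinorNorm B g = sqCoset c` says that `g` has such a factorization and that every such
factorization gives the class of `c`. -/
def spinorNorm (B : Matrix n n F) (g : Matrix n n F) : Set F :=
  {y | ∃ us : List (n → F), (∀ u ∈ us, formVal B u u ≠ 0) ∧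
      g = (us.map (reflectionMatrix B)).prod ∧
      y ∈ sqCoset (us.map fun u => formVal B u u / 2).prod}

end SpinorNorm

section Twisted

/-- The index set of the basis `e₁, e₋₁, e₂, …, e_l, e₋₂, …, e₋_l`, where `l = m + 1`. The elements
of the two copies of `Fin m` are the indices `2, …, l` and `-2, …, -l`. -/
abbrev TwIdx (m : ℕ) : Type := Fin 2 ⊕ (Fin m ⊕ Fin m)

/-- The index `1`. -/
abbrev idxOne (m : ℕ) : TwIdx m := Sum.inl 0

/-- The index `-1`. -/
abbrev idxNegOne (m : ℕ) : TwIdx m := Sum.inl 1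

/-- The index `i` in the range `2, …, l`. -/
abbrev idxPos {m : ℕ} (i : Fin m) : TwIdx m := Sum.inr (Sum.inl i)

/-- The index `-i`, for `i` in the range `2, …, l`. -/
abbrev idxNeg {m : ℕ} (i : Fin m) : TwIdx m := Sum.inr (Sum.inr i)

variable {F : Type*} [Field F]

/-- The matrix of the form: `diag(1, ε)` on `e₁, e₋₁`, and `(0, I; I, 0)` on the other basis
vectors. -/
def twistedForm (ε : F) (m : ℕ) : Matrix (TwIdx m) (TwIdx m) F :=
  fromBlocks !![1, 0; 0, ε] 0 0 (fromBlocks 0 1 1 0)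

/-- The twisted orthogonal group `O⁻(2l, q)`, with `l = m + 1`. -/
def twistedOrthogonalGroup (ε : F) (m : ℕ) : Subgroup (GL (TwIdx m) F) where
  carrier := {g | (g : Matrix (TwIdx m) (TwIdx m) F)ᵀ * twistedForm ε m *
    (g : Matrix (TwIdx m) (TwIdx m) F) = twistedForm ε m}
  one_mem' := by simp
  mul_mem' := by
    intro a b ha hb
    simp only [Set.mem_ofPred_eq] at ha hb ⊢
    calc ((a * b : GL (TwIdx m) F) : Matrix (TwIdx m) (TwIdx m) F)ᵀ * twistedForm ε m *
          ((a * b : GL (TwIdx m) F) : Matrix (TwIdx m) (TwIdx m) F)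
        = (b : Matrix (TwIdx m) (TwIdx m) F)ᵀ * ((a : Matrix (TwIdx m) (TwIdx m) F)ᵀ *
          twistedForm ε m * (a : Matrix (TwIdx m) (TwIdx m) F)) *
          (b : Matrix (TwIdx m) (TwIdx m) F) := by
          simp only [Units.val_mul, transpose_mul, Matrix.mul_assoc]
      _ = twistedForm ε m := by rw [ha, hb]
  inv_mem' := by
    intro a ha
    simp only [Set.mem_ofPred_eq] at ha ⊢
    have h1 : (a : Matrix (TwIdx m) (TwIdx m) F) *
        ((a⁻¹ : GL (TwIdx m) F) : Matrix (TwIdx m) (TwIdx m) F) = 1 := by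
      rw [← Units.val_mul, mul_inv_cancel, Units.val_one]
    have h2 : ((a⁻¹ : GL (TwIdx m) F) : Matrix (TwIdx m) (TwIdx m) F)ᵀ *
        (a : Matrix (TwIdx m) (TwIdx m) F)ᵀ = 1 := by
      rw [← transpose_mul, h1, transpose_one]
    calc ((a⁻¹ : GL (TwIdx m) F) : Matrix (TwIdx m) (TwIdx m) F)ᵀ * twistedForm ε m *
          ((a⁻¹ : GL (TwIdx m) F) : Matrix (TwIdx m) (TwIdx m) F)
        = (((a⁻¹ : GL (TwIdx m) F) : Matrix (TwIdx m) (TwIdx m) F)ᵀ *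
          (a : Matrix (TwIdx m) (TwIdx m) F)ᵀ) * twistedForm ε m *
          ((a : Matrix (TwIdx m) (TwIdx m) F) *
          ((a⁻¹ : GL (TwIdx m) F) : Matrix (TwIdx m) (TwIdx m) F)) := by
          conv_lhs => rw [← ha]
          simp only [Matrix.mul_assoc]
      _ = twistedForm ε m := by rw [h1, h2, Matrix.one_mul, Matrix.mul_one]

/-- The matrix unit `e_{a,b}`. -/
abbrev matUnit {m : ℕ} (a b : TwIdx m) : Matrix (TwIdx m) (TwIdx m) F := Matrix.single a b 1

/-- The unipotent elementary matrices of `O⁻(2l, q)`. -/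
inductive IsElementary (ε : F) {m : ℕ} : Matrix (TwIdx m) (TwIdx m) F → Prop
  /-- `x_{i,j}(t)` -/
  | pos_pos (i j : Fin m) (hij : i ≠ j) (t : F) : IsElementary ε
      (1 + t • (matUnit (idxPos i) (idxPos j) - matUnit (idxNeg j) (idxNeg i)))
  /-- `x_{i,-j}(t)` -/
  | pos_neg (i j : Fin m) (hij : i < j) (t : F) : IsElementary ε
      (1 + t • (matUnit (idxPos i) (idxNeg j) - matUnit (idxPos j) (idxNeg i)))
  /-- `x_{-i,j}(t)` -/
  | neg_pos (i j : Fin m) (hij : i < j) (t : F) : IsElementary ε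
      (1 + t • (matUnit (idxNeg i) (idxPos j) - matUnit (idxNeg j) (idxPos i)))
  /-- `x_{i,1}(t)` -/
  | pos_one (i : Fin m) (t : F) : IsElementary ε
      (1 + t • (matUnit (idxOne m) (idxPos i) - matUnit (idxNeg i) (idxOne m))
        - (t ^ 2 / 2) • matUnit (idxNeg i) (idxPos i))
  /-- `x_{1,i}(t)` -/
  | one_pos (i : Fin m) (t : F) : IsElementary ε
      (1 + t • (matUnit (idxPos i) (idxOne m) - matUnit (idxOne m) (idxNeg i))
        - (t ^ 2 / 2) • matUnit (idxPos i) (idxNeg i))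
  /-- `x_{i,-1}(t)` -/
  | pos_negOne (i : Fin m) (t : F) : IsElementary ε
      (1 + t • (matUnit (idxNegOne m) (idxPos i) - ε • matUnit (idxNeg i) (idxNegOne m))
        - (ε * t ^ 2 / 2) • matUnit (idxNeg i) (idxPos i))
  /-- `x_{-1,i}(t)` -/
  | negOne_pos (i : Fin m) (t : F) : IsElementary ε
      (1 + t • (ε • matUnit (idxPos i) (idxNegOne m) - matUnit (idxNegOne m) (idxNeg i))
        - (ε * t ^ 2 / 2) • matUnit (idxPos i) (idxNeg i))

/-- The elementary matrix `w_i`, which interchanges `e_i` and `e₋ᵢ` up to sign. -/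
def elemW {m : ℕ} (i : Fin m) : Matrix (TwIdx m) (TwIdx m) F :=
  1 - matUnit (idxPos i) (idxPos i) - matUnit (idxNeg i) (idxNeg i)
    - matUnit (idxPos i) (idxNeg i) - matUnit (idxNeg i) (idxPos i)

/-- `Reduces ε g N h`: a finite sequence of elementary row and column operations, exactly `N` of
which are multiplications by matrices `w_i`, transforms `g` into `h`. -/
inductive Reduces (ε : F) {m : ℕ} (g : Matrix (TwIdx m) (TwIdx m) F) :
    ℕ → Matrix (TwIdx m) (TwIdx m) F → Prop
  | refl : Reduces ε g 0 g
  | row {N : ℕ} {h x : Matrix (TwIdx m) (TwIdx m) F} (hr : Reduces ε g N h)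
      (hx : IsElementary ε x) : Reduces ε g N (x * h)
  | col {N : ℕ} {h x : Matrix (TwIdx m) (TwIdx m) F} (hr : Reduces ε g N h)
      (hx : IsElementary ε x) : Reduces ε g N (h * x)
  | rowW {N : ℕ} {h : Matrix (TwIdx m) (TwIdx m) F} (hr : Reduces ε g N h)
      (i : Fin m) : Reduces ε g (N + 1) (elemW i * h)
  | colW {N : ℕ} {h : Matrix (TwIdx m) (TwIdx m) F} (hr : Reduces ε g N h)
      (i : Fin m) : Reduces ε g (N + 1) (h * elemW i)

/-- The diagonal `m × m` matrix `diag(1, …, 1, c)`. -/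
def lastDiag (m : ℕ) (c : F) : Matrix (Fin m) (Fin m) F :=
  diagonal fun i => if (i : ℕ) + 1 = m then c else 1

/-- The block diagonal matrix with blocks `A₀`, `diag(1, …, 1, lam)`, `diag(1, …, 1, lam⁻¹)`. -/
def outputMatrix {m : ℕ} (A₀ : Matrix (Fin 2) (Fin 2) F) (lam : Fˣ) :
    Matrix (TwIdx m) (TwIdx m) F :=
  fromBlocks A₀ 0 0
    (fromBlocks (lastDiag m (lam : F)) 0 0 (lastDiag m ((lam⁻¹ : Fˣ) : F)))

/-- Gaussian elimination, with `N` uses of the matrices `w_i`, reduces `g` to the block diagonal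
matrix with blocks `A₀`, `diag(1, …, 1, lam)`, `diag(1, …, 1, lam⁻¹)`. When `m = 0` the last two
blocks are empty and `lam` is `1` by convention. -/
def IsGaussianOutput (ε : F) {m : ℕ} (g : Matrix (TwIdx m) (TwIdx m) F) (N : ℕ)
    (A₀ : Matrix (Fin 2) (Fin 2) F) (lam : Fˣ) : Prop :=
  (m = 0 → lam = 1) ∧ Reduces ε g N (outputMatrix A₀ lam)

end Twisted

/-
Elementary matrices are Siegel transformations `x ↦ x + β(f,x) v - β(v,x) f - (β(v,v)/2) β(f,x) f`
with `f` an isotropic basis vector. When `v` is anisotropic such a transformation is a product of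
reflections in two vectors of the same length, so its determinant and its spinor norm are trivial,
while `w_i` is the reflection in `e_i + e_{-i}`, of determinant `-1` and trivial spinor norm. Hence
elimination changes the determinant by `(-1)^N` and preserves the spinor norm, and both can be read
off the output: `A₀` is an isometry of the plane with form `diag(1, ε)`, that is, a rotation or a
reflection, and the two diagonal blocks contribute `λ`.

That the spinor norm does not depend on the factorization follows Wall: a product of `k` reflections
is `1 - U T⁻¹ ᵗU B`, where `T` is triangular with diagonal `β(u_i, u_i) / 2` and `T + ᵗT = ᵗU B U`.
If the product is `1`, the determinant of `T` equals that of the skew-symmetric matrix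
`T - ᵗU B U / 2`, which is a square.
-/

section SkewSymmetric

variable {F : Type*} [Field F]

lemma apply_self_eq_zero_of_transpose_eq_neg (h2 : (2 : F) ≠ 0) {ι : Type*} {S : Matrix ι ι F}
    (hS : Sᵀ = -S) (i : ι) : S i i = 0 := by
  have h : S i i = -S i i := congrFun (congrFun hS i) i
  exact (mul_eq_zero.1 (by linear_combination h : 2 * S i i = 0)).resolve_left h2

lemma exists_det_fromBlocks_eq_sq_mul {ι : Type*} [Fintype ι] [DecidableEq ι]
    (h2 : (2 : F) ≠ 0) {A : Matrix (Fin 2) (Fin 2) F} {C : Matrix ι (Fin 2) F}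
    {D : Matrix ι ι F} (hA : Aᵀ = -A) (hA01 : A 0 1 ≠ 0) (hD : Dᵀ = -D) :
    ∃ S : Matrix ι ι F, Sᵀ = -S ∧ (fromBlocks A (-Cᵀ) C D).det = A 0 1 ^ 2 * S.det := by
  have hdet : A.det = A 0 1 ^ 2 := by
    have h : A 1 0 = -A 0 1 := congrFun (congrFun hA 0) 1
    rw [det_fin_two, apply_self_eq_zero_of_transpose_eq_neg h2 hA, h]
    ring
  have hunit : IsUnit A.det := by simp [hdet, hA01]
  have := A.invertibleOfIsUnitDet hunit
  have hinv : (⅟A)ᵀ = -⅟A := by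
    simp only [invOf_eq_nonsing_inv, transpose_nonsing_inv, hA]
    exact inv_eq_left_inv (by simp [nonsing_inv_mul _ hunit])
  refine ⟨_, ?_, (det_fromBlocks₁₁ A (-Cᵀ) C D).trans (by rw [hdet])⟩
  simp only [transpose_sub, transpose_mul, transpose_neg, transpose_transpose, hinv, hD,
    Matrix.mul_neg, Matrix.neg_mul, Matrix.mul_assoc]
  abel

theorem isSquare_det_of_transpose_eq_neg (h2 : (2 : F) ≠ 0) {ι : Type*} [Fintype ι]
    [DecidableEq ι] {S : Matrix ι ι F} (hS : Sᵀ = -S) : IsSquare S.det := by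
  induction hn : Fintype.card ι using Nat.strong_induction_on generalizing ι with
  | _ n ih =>
  by_cases hS0 : S = 0
  · cases isEmpty_or_nonempty ι <;> simp [hS0]
  obtain ⟨i, j, hij⟩ : ∃ i j, S i j ≠ 0 := by
    by_contra! h
    exact hS0 (Matrix.ext h)
  have hinj : Function.Injective ![i, j] := by
    have hne : i ≠ j := by
      rintro rfl
      exact hij (apply_self_eq_zero_of_transpose_eq_neg h2 hS i)
    simp [Function.Injective, Fin.forall_fin_two, hne, hne.symm]
  let e : Fin 2 ⊕ ↥(Set.range ![i, j])ᶜ ≃ ι :=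
    ((Equiv.ofInjective _ hinj).sumCongr (Equiv.refl _)).trans (Equiv.Set.sumCompl _)
  have hcard : Fintype.card ↥(Set.range ![i, j])ᶜ < n := by
    have := Fintype.card_congr e
    rw [Fintype.card_sum, Fintype.card_fin, hn] at this
    omega
  have hskew : (S.submatrix e e)ᵀ = -S.submatrix e e := congrArg (·.submatrix e e) hS
  rw [← fromBlocks_toBlocks (S.submatrix e e), fromBlocks_transpose, fromBlocks_neg,
    fromBlocks_inj] at hskew
  obtain ⟨hA, hCB, -, hD⟩ := hskew
  obtain ⟨T, hT, hdet⟩ := exists_det_fromBlocks_eq_sq_mul (C := (S.submatrix e e).toBlocks₂₁)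
    h2 hA (show S (e (Sum.inl 0)) (e (Sum.inl 1)) ≠ 0 from hij) hD
  rw [← det_submatrix_equiv_self e, ← fromBlocks_toBlocks (S.submatrix e e),
    ← neg_eq_iff_eq_neg.2 hCB, hdet]
  exact (IsSquare.sq _).mul (ih _ hcard hT rfl)

end SkewSymmetric

section BilinearForm

variable {F : Type*} [Field F] {n : Type*} [Fintype n]

section FormVal

variable (B : Matrix n n F) (c : F) (u v w : n → F)

lemma formVal_add_left : formVal B (u + v) w = formVal B u w + formVal B v w := by
  simp [formVal, add_dotProduct]

lemma formVal_add_right : formVal B u (v + w) = formVal B u v + formVal B u w := by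
  simp [formVal, mulVec_add, dotProduct_add]

lemma formVal_smul_left : formVal B (c • u) v = c * formVal B u v := by
  simp [formVal]

lemma formVal_smul_right : formVal B u (c • v) = c * formVal B u v := by
  simp [formVal, mulVec_smul]

lemma formVal_neg_left : formVal B (-u) v = -formVal B u v := by
  simp [formVal]

lemma formVal_neg_right : formVal B u (-v) = -formVal B u v := by
  simp [formVal, mulVec_neg]

lemma formVal_sub_left : formVal B (u - v) w = formVal B u w - formVal B v w := by
  simp [formVal, sub_dotProduct]

lemma formVal_sub_right : formVal B u (v - w) = formVal B u v - formVal B u w := by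
  simp [formVal, mulVec_sub]

end FormVal

lemma formVal_comm {B : Matrix n n F} (hB : B.IsSymm) (u v : n → F) :
    formVal B u v = formVal B v u := by
  rw [formVal, formVal, dotProduct_comm, dotProduct_mulVec v, ← mulVec_transpose, hB.eq]

lemma matrix_ext_mulVec {A A' : Matrix n n F} (h : ∀ x, A *ᵥ x = A' *ᵥ x) : A = A' :=
  mulVec_injective (funext h)

variable [DecidableEq n]

lemma reflectionMatrix_mulVec (B : Matrix n n F) (u x : n → F) :
    reflectionMatrix B u *ᵥ x = x - (2 / formVal B u u * formVal B u x) • u := by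
  rw [reflectionMatrix, sub_mulVec, one_mulVec, smul_mulVec, vecMulVec_mulVec,
    ← dotProduct_mulVec, op_smul_eq_smul, smul_smul, formVal, formVal]

lemma reflectionMatrix_mul_self {B : Matrix n n F} {u : n → F} (hu : formVal B u u ≠ 0) :
    reflectionMatrix B u * reflectionMatrix B u = 1 :=
  matrix_ext_mulVec fun x => by
    simp only [← mulVec_mulVec, one_mulVec, reflectionMatrix_mulVec, formVal_sub_right,
      formVal_smul_right]
    match_scalars
    · ring
    · field_simp
      ring

lemma det_reflectionMatrix {B : Matrix n n F} {u : n → F} (hu : formVal B u u ≠ 0) :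
    (reflectionMatrix B u).det = -1 := by
  rw [reflectionMatrix, sub_eq_add_neg, ← neg_smul, ← smul_vecMulVec, vecMulVec_eq Unit,
    det_one_add_replicateCol_mul_replicateRow, dotProduct_smul, ← dotProduct_mulVec, ← formVal,
    smul_eq_mul]
  field_simp
  ring

end BilinearForm

section WallForm

variable {F : Type*} [Field F] {n : Type*} [Fintype n] [DecidableEq n] {B : Matrix n n F}

/-- A presentation `g = 1 - U T⁻¹ ᵗU B` of an isometry of `B` by a frame `U` of a subspace
containing the image of `1 - g` and the Gram matrix `T` of the Wall form with respect to `U`. The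
columns of `U` may be linearly dependent. -/
structure IsWallPresentation {ι : Type*} [Fintype ι] [DecidableEq ι] (B g : Matrix n n F)
    (U : Matrix n ι F) (T : Matrix ι ι F) : Prop where
  isUnit_det : IsUnit T.det
  add_transpose : T + Tᵀ = Uᵀ * B * U
  eq : g = 1 - U * T⁻¹ * Uᵀ * B

variable {ι κ : Type*} [Fintype ι] [DecidableEq ι] [Fintype κ] [DecidableEq κ]

lemma isWallPresentation_one [IsEmpty ι] (U : Matrix n ι F) (T : Matrix ι ι F) :
    IsWallPresentation B 1 U T where
  isUnit_det := by simp
  add_transpose := Subsingleton.elim _ _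
  eq := by rw [show U = 0 from Subsingleton.elim _ _]; simp

lemma isWallPresentation_reflectionMatrix (h2 : (2 : F) ≠ 0) {u : n → F}
    (hu : formVal B u u ≠ 0) : IsWallPresentation B (reflectionMatrix B u)
      (replicateCol Unit u) ((formVal B u u / 2) • (1 : Matrix Unit Unit F)) where
  isUnit_det := by simp [hu, h2]
  add_transpose := by
    have := NeZero.mk h2
    ext
    rw [transpose_replicateCol, ← replicateRow_vecMul, replicateRow_mul_replicateCol_apply,
      ← dotProduct_mulVec, ← formVal]
    simp
  eq := by
    have h : ((formVal B u u / 2) • (1 : Matrix Unit Unit F))⁻¹ = (2 / formVal B u u) • 1 :=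
      inv_eq_right_inv (by ext; simp [h2, hu])
    rw [reflectionMatrix, h, Matrix.mul_smul, Matrix.mul_one, transpose_replicateCol, smul_mul,
      smul_mul, Matrix.mul_assoc, ← replicateRow_vecMul, vecMulVec_eq Unit]

lemma IsWallPresentation.mul (hB : B.IsSymm) {g h : Matrix n n F} {U : Matrix n ι F}
    {T : Matrix ι ι F} {V : Matrix n κ F} {S : Matrix κ κ F} (hg : IsWallPresentation B g U T)
    (hh : IsWallPresentation B h V S) :
    IsWallPresentation B (g * h) (fromCols U V) (fromBlocks T (Uᵀ * B * V) 0 S) where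
  isUnit_det := by
    rw [det_fromBlocks_zero₂₁]
    exact hg.isUnit_det.mul hh.isUnit_det
  add_transpose := by
    rw [fromBlocks_transpose, fromBlocks_add, hg.add_transpose, hh.add_transpose,
      transpose_fromCols, fromRows_mul, fromRows_mul_fromCols]
    simp [Matrix.mul_assoc, hB.eq]
  eq := by
    have hT := (isUnit_iff_isUnit_det T).2 hg.isUnit_det
    have hS := (isUnit_iff_isUnit_det S).2 hh.isUnit_det
    rw [inv_fromBlocks_zero₂₁_of_isUnit_iff _ _ _ (iff_of_true hT hS), hg.eq, hh.eq,
      fromCols_mul_fromBlocks, transpose_fromCols, fromCols_mul_fromRows]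
    simp only [Matrix.mul_assoc, Matrix.mul_sub, Matrix.sub_mul, Matrix.add_mul,
      Matrix.mul_neg, Matrix.neg_mul, Matrix.mul_one, Matrix.one_mul, Matrix.mul_zero,
      Matrix.zero_mul]
    abel

/-- The trivial isometry has `U T⁻¹ ᵗU B = 0`, so that `T` and the skew-symmetric matrix
`T - ᵗU B U / 2` have the same determinant. -/
lemma IsWallPresentation.isSquare_det (h2 : (2 : F) ≠ 0) (hB : B.IsSymm) {U : Matrix n ι F}
    {T : Matrix ι ι F} (h : IsWallPresentation B 1 U T) : IsSquare T.det := by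
  have hzero : U * T⁻¹ * Uᵀ * B = 0 := by simpa [eq_sub_iff_add_eq] using h.eq
  have hdet : (T + (-(2⁻¹ : F) • (Uᵀ * B)) * U).det = T.det := by
    rw [det_add_mul _ _ h.isUnit_det]
    simp [← Matrix.mul_assoc, hzero]
  rw [← hdet]
  apply isSquare_det_of_transpose_eq_neg h2
  have hTT : Tᵀ = Uᵀ * B * U - T := eq_sub_of_add_eq' h.add_transpose
  simp only [transpose_add, transpose_mul, transpose_smul, transpose_transpose, hB.eq, hTT]
  rw [Matrix.mul_smul, smul_mul, ← Matrix.mul_assoc]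
  match_scalars <;> field_simp
  norm_num

lemma exists_isWallPresentation (h2 : (2 : F) ≠ 0) (hB : B.IsSymm) {us : List (n → F)}
    (hus : ∀ u ∈ us, formVal B u u ≠ 0) :
    ∃ (ι : Type) (_ : Fintype ι) (_ : DecidableEq ι) (U : Matrix n ι F) (T : Matrix ι ι F),
      IsWallPresentation B (us.map (reflectionMatrix B)).prod U T ∧
        T.det = (us.map fun u => formVal B u u / 2).prod := by
  induction us with
  | nil => exact ⟨Empty, inferInstance, inferInstance, 0, 0, isWallPresentation_one _ _, by simp⟩
  | cons u us ih =>
    obtain ⟨ι, _, _, U, T, hUT, hdet⟩ := ih fun v hv => hus v (List.mem_cons_of_mem _ hv)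
    refine ⟨Unit ⊕ ι, inferInstance, inferInstance, _, _,
      (isWallPresentation_reflectionMatrix h2 (hus u List.mem_cons_self)).mul hB hUT, ?_⟩
    simp [hdet]

lemma isSquare_prod_of_prod_reflectionMatrix_eq_one (h2 : (2 : F) ≠ 0) (hB : B.IsSymm)
    {us : List (n → F)} (hus : ∀ u ∈ us, formVal B u u ≠ 0)
    (h : (us.map (reflectionMatrix B)).prod = 1) :
    IsSquare (us.map fun u => formVal B u u / 2).prod := by
  obtain ⟨ι, _, _, U, T, hUT, hdet⟩ := exists_isWallPresentation h2 hB hus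
  rw [← hdet]
  exact (h ▸ hUT).isSquare_det h2 hB

end WallForm

section SpinorClass

variable {F : Type*} [Field F] {n : Type*} [Fintype n] [DecidableEq n]

/-- `g` is a product of reflections in anisotropic vectors, one such factorization of which has
spinor norm the class of `c`. -/
def HasSpinorClass (B g : Matrix n n F) (c : F) : Prop :=
  ∃ us : List (n → F), (∀ u ∈ us, formVal B u u ≠ 0) ∧
    g = (us.map (reflectionMatrix B)).prod ∧
    (us.map fun u => formVal B u u / 2).prod ∈ sqCoset c

lemma hasSpinorClass_one (B : Matrix n n F) : HasSpinorClass B 1 1 :=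
  ⟨[], by simp, by simp, 1, by simp⟩

lemma hasSpinorClass_reflectionMatrix {B : Matrix n n F} {u : n → F} (hu : formVal B u u ≠ 0) :
    HasSpinorClass B (reflectionMatrix B u) (formVal B u u / 2) :=
  ⟨[u], by simpa using hu, by simp, 1, by simp⟩

namespace HasSpinorClass

variable {B g h : Matrix n n F} {c d : F}

lemma mul (hg : HasSpinorClass B g c) (hh : HasSpinorClass B h d) :
    HasSpinorClass B (g * h) (c * d) := by
  obtain ⟨us, hus, rfl, x, hx, hxc⟩ := hg
  obtain ⟨vs, hvs, rfl, y, hy, hyd⟩ := hh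
  refine ⟨us ++ vs, List.forall_mem_append.2 ⟨hus, hvs⟩, by simp, x * y, mul_ne_zero hx hy, ?_⟩
  rw [List.map_append, List.prod_append, hxc, hyd]
  ring

lemma of_mul_sq {x : F} (hg : HasSpinorClass B g (c * x ^ 2)) (hx : x ≠ 0) :
    HasSpinorClass B g c := by
  obtain ⟨us, hus, rfl, y, hy, hyc⟩ := hg
  exact ⟨us, hus, rfl, x * y, mul_ne_zero hx hy, by rw [hyc]; ring⟩

lemma exists_inv (hg : HasSpinorClass B g c) : ∃ g', g' * g = 1 ∧ HasSpinorClass B g' c := by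
  obtain ⟨us, hus, rfl, x, hx, hxc⟩ := hg
  refine ⟨(us.reverse.map (reflectionMatrix B)).prod, ?_, us.reverse, by simpa using hus, rfl,
    x, hx, by rw [List.map_reverse, List.prod_reverse, hxc]⟩
  clear hxc
  induction us with
  | nil => simp
  | cons u us ih =>
    rw [List.forall_mem_cons] at hus
    simp only [List.reverse_cons, List.map_append, List.map_cons, List.map_nil, List.prod_append,
      List.prod_cons, List.prod_nil, mul_one]
    rw [mul_assoc, ← mul_assoc (reflectionMatrix B u), reflectionMatrix_mul_self hus.1, one_mul,
      ih hus.2]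

lemma of_mul_left (hg : HasSpinorClass B g c) (hgh : HasSpinorClass B (g * h) d) :
    HasSpinorClass B h (c * d) := by
  obtain ⟨g', hg'g, hg'⟩ := hg.exists_inv
  simpa [← mul_assoc, hg'g] using hg'.mul hgh

lemma of_mul_right (hg : HasSpinorClass B g c) (hhg : HasSpinorClass B (h * g) d) :
    HasSpinorClass B h (d * c) := by
  obtain ⟨g', hg'g, hg'⟩ := hg.exists_inv
  simpa [mul_assoc, mul_eq_one_comm.1 hg'g] using hhg.mul hg'

lemma det_sq (hg : HasSpinorClass B g c) : g.det ^ 2 = 1 := by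
  obtain ⟨us, hus, rfl, -⟩ := hg
  induction us with
  | nil => simp
  | cons u us ih =>
    rw [List.forall_mem_cons] at hus
    rw [List.map_cons, List.prod_cons, det_mul, mul_pow, det_reflectionMatrix hus.1, ih hus.2]
    norm_num

lemma ne_zero (h2 : (2 : F) ≠ 0) (hg : HasSpinorClass B g c) : c ≠ 0 := by
  rintro rfl
  obtain ⟨us, hus, -, x, -, hx⟩ := hg
  rw [zero_mul, List.prod_eq_zero_iff, List.mem_map] at hx
  obtain ⟨u, hu, hu0⟩ := hx
  exact div_ne_zero (hus u hu) h2 hu0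

lemma isSquare (h2 : (2 : F) ≠ 0) (hB : B.IsSymm) (h : HasSpinorClass B 1 c) : IsSquare c := by
  obtain ⟨us, hus, hprod, x, hx, hxc⟩ := h
  have := isSquare_prod_of_prod_reflectionMatrix_eq_one h2 hB hus hprod.symm
  rw [hxc] at this
  simpa [hx] using this.div (IsSquare.sq x)

theorem spinorNorm_eq (h2 : (2 : F) ≠ 0) (hB : B.IsSymm) (hg : HasSpinorClass B g c) :
    spinorNorm B g = sqCoset c := by
  ext y
  constructor
  · rintro ⟨vs, hvs, hgvs, z, hz, rfl⟩
    set b := (vs.map fun u => formVal B u u / 2).prod with hb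
    have hgb : HasSpinorClass B g b := ⟨vs, hvs, hgvs, 1, one_ne_zero, by simp [hb]⟩
    have hcb : HasSpinorClass B 1 (c * b) := hg.of_mul_left (by simpa using hgb)
    obtain ⟨a, ha⟩ := hcb.isSquare h2 hB
    have hc : c ≠ 0 := hg.ne_zero h2
    have ha0 : a ≠ 0 := by
      rintro rfl
      exact hcb.ne_zero h2 (by simpa using ha)
    exact ⟨a * z / c, div_ne_zero (mul_ne_zero ha0 hz) hc, by
      field_simp
      linear_combination ha⟩
  · rintro ⟨z, hz, rfl⟩
    obtain ⟨us, hus, rfl, x, hx, hxc⟩ := hg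
    exact ⟨us, hus, rfl, z / x, div_ne_zero hz hx, by rw [hxc]; field_simp⟩

end HasSpinorClass

end SpinorClass

section OrthogonalSum

variable {F : Type*} [Field F] {n p : Type*} [Fintype n] [DecidableEq n] [Fintype p]
  [DecidableEq p]

lemma HasSpinorClass.map {B g : Matrix n n F} {B' : Matrix p p F} {c : F}
    (hg : HasSpinorClass B g c) (φ : Matrix n n F →* Matrix p p F) (f : (n → F) → p → F)
    (hf : ∀ u, formVal B' (f u) (f u) = formVal B u u)
    (hφ : ∀ u, φ (reflectionMatrix B u) = reflectionMatrix B' (f u)) :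
    HasSpinorClass B' (φ g) c := by
  obtain ⟨us, hus, rfl, hc⟩ := hg
  refine ⟨us.map f, ?_, ?_, ?_⟩
  · simpa [hf] using hus
  · simp only [map_list_prod, List.map_map, Function.comp_def, hφ]
  · simpa only [List.map_map, Function.comp_def, hf] using hc

lemma hasSpinorClass_fromBlocks {B₁ g₁ : Matrix n n F} {B₂ g₂ : Matrix p p F} {c₁ c₂ : F}
    (h₁ : HasSpinorClass B₁ g₁ c₁) (h₂ : HasSpinorClass B₂ g₂ c₂) :
    HasSpinorClass (fromBlocks B₁ 0 0 B₂) (fromBlocks g₁ 0 0 g₂) (c₁ * c₂) := by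
  let φ₁ : Matrix n n F →* Matrix (n ⊕ p) (n ⊕ p) F :=
    { toFun g := fromBlocks g 0 0 1
      map_one' := fromBlocks_one
      map_mul' := by simp [fromBlocks_multiply] }
  let φ₂ : Matrix p p F →* Matrix (n ⊕ p) (n ⊕ p) F :=
    { toFun g := fromBlocks 1 0 0 g
      map_one' := fromBlocks_one
      map_mul' := by simp [fromBlocks_multiply] }
  have hmul : fromBlocks g₁ 0 0 g₂ = φ₁ g₁ * φ₂ g₂ := by simp [φ₁, φ₂, fromBlocks_multiply]
  rw [hmul]
  refine (h₁.map φ₁ (Sum.elim · 0) (fun u => ?_) fun u => ?_).mul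
    (h₂.map φ₂ (Sum.elim 0) (fun u => ?_) fun u => ?_)
  · simp [formVal, fromBlocks_mulVec]
  · refine matrix_ext_mulVec fun x => funext ?_
    rintro (i | i) <;> simp [φ₁, reflectionMatrix_mulVec, fromBlocks_mulVec, formVal]
  · simp [formVal, fromBlocks_mulVec]
  · refine matrix_ext_mulVec fun x => funext ?_
    rintro (i | i) <;> simp [φ₂, reflectionMatrix_mulVec, fromBlocks_mulVec, formVal]

end OrthogonalSum

section Isometry

variable {F : Type*} [Field F] {n : Type*} [Fintype n] [DecidableEq n]

/-- The monoid of matrices preserving the bilinear form with matrix `B`. -/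
def isometrySubmonoid (B : Matrix n n F) : Submonoid (Matrix n n F) where
  carrier := {g | ∀ u v, formVal B (g *ᵥ u) (g *ᵥ v) = formVal B u v}
  one_mem' u v := by simp
  mul_mem' {g h} hg hh u v := by rw [← mulVec_mulVec, ← mulVec_mulVec, hg, hh]

variable {B : Matrix n n F}

lemma transpose_mul_mul_eq_iff_mem_isometrySubmonoid {g : Matrix n n F} :
    gᵀ * B * g = B ↔ g ∈ isometrySubmonoid B := by
  have h (u v : n → F) : formVal B (g *ᵥ u) (g *ᵥ v) = formVal (gᵀ * B * g) u v := by
    simp only [formVal, ← mulVec_mulVec, dotProduct_mulVec, vecMul_transpose]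
  refine ⟨fun hg u v => by rw [h, hg], fun hg => Matrix.ext fun i j => ?_⟩
  have hij := hg (Pi.single i 1) (Pi.single j 1)
  rw [h] at hij
  simpa [formVal] using hij

lemma reflectionMatrix_mem_isometrySubmonoid (hB : B.IsSymm) {u : n → F}
    (hu : formVal B u u ≠ 0) : reflectionMatrix B u ∈ isometrySubmonoid B := by
  intro x y
  simp only [reflectionMatrix_mulVec, formVal_sub_right, formVal_smul_right, formVal_sub_left,
    formVal_smul_left, formVal_comm hB x u]
  field_simp
  ring

lemma HasSpinorClass.mem_isometrySubmonoid (hB : B.IsSymm) {g : Matrix n n F} {c : F}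
    (hg : HasSpinorClass B g c) : g ∈ isometrySubmonoid B := by
  obtain ⟨us, hus, rfl, -⟩ := hg
  exact Submonoid.list_prod_mem _ (List.forall_mem_map.2 fun u hu =>
    reflectionMatrix_mem_isometrySubmonoid hB (hus u hu))

end Isometry

section Siegel

variable {F : Type*} [Field F] {n : Type*} [Fintype n] [DecidableEq n]

/-- The Siegel transformation `x ↦ x + β(f,x) v - β(v,x) f - (β(v,v)/2) β(f,x) f`, an isometry
when `f` is isotropic and orthogonal to `v`. -/
def siegelMatrix (B : Matrix n n F) (f v : n → F) : Matrix n n F :=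
  1 + vecMulVec v (f ᵥ* B) - vecMulVec f (v ᵥ* B) -
    (formVal B v v / 2) • vecMulVec f (f ᵥ* B)

lemma siegelMatrix_mulVec (B : Matrix n n F) (f v x : n → F) :
    siegelMatrix B f v *ᵥ x = x + formVal B f x • v - formVal B v x • f -
      (formVal B v v / 2 * formVal B f x) • f := by
  simp only [siegelMatrix, sub_mulVec, add_mulVec, one_mulVec, smul_mulVec, vecMulVec_mulVec,
    ← dotProduct_mulVec, op_smul_eq_smul, smul_smul, formVal]

lemma siegelMatrix_zero (B : Matrix n n F) (f : n → F) : siegelMatrix B f 0 = 1 := by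
  simp [siegelMatrix, formVal]

variable {B : Matrix n n F} {f v w e : n → F}

lemma siegelMatrix_mul (h2 : (2 : F) ≠ 0) (hB : B.IsSymm) (hf : formVal B f f = 0)
    (hv : formVal B f v = 0) (hw : formVal B f w = 0) :
    siegelMatrix B f v * siegelMatrix B f w = siegelMatrix B f (v + w) :=
  matrix_ext_mulVec fun x => by
    rw [← mulVec_mulVec]
    simp only [siegelMatrix_mulVec, formVal_add_left, formVal_add_right, formVal_sub_right,
      formVal_smul_right, hf, hv, hw, formVal_comm hB v f, formVal_comm hB w v]
    match_scalars <;> field_simp <;> ring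

lemma siegelMatrix_eq_mul_reflectionMatrix (h2 : (2 : F) ≠ 0) (hB : B.IsSymm)
    (hf : formVal B f f = 0) (hfv : formVal B f v = 0) (hv : formVal B v v ≠ 0) :
    siegelMatrix B f v =
      reflectionMatrix B v * reflectionMatrix B (v + (formVal B v v / 2) • f) :=
  matrix_ext_mulVec fun x => by
    rw [← mulVec_mulVec]
    simp only [siegelMatrix_mulVec, reflectionMatrix_mulVec, formVal_add_left, formVal_add_right,
      formVal_sub_right, formVal_smul_left, formVal_smul_right, hf, hfv, formVal_comm hB v f,
      mul_zero, add_zero]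
    match_scalars <;> field_simp <;> ring

lemma hasSpinorClass_siegelMatrix_of_anisotropic (h2 : (2 : F) ≠ 0) (hB : B.IsSymm)
    (hf : formVal B f f = 0) (hfv : formVal B f v = 0) (hv : formVal B v v ≠ 0) :
    HasSpinorClass B (siegelMatrix B f v) 1 := by
  have hw : formVal B (v + (formVal B v v / 2) • f) (v + (formVal B v v / 2) • f) =
      formVal B v v := by
    simp only [formVal_add_left, formVal_add_right, formVal_smul_left, formVal_smul_right, hf, hfv,
      formVal_comm hB v f]
    ring
  rw [siegelMatrix_eq_mul_reflectionMatrix h2 hB hf hfv hv]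
  have h := (hasSpinorClass_reflectionMatrix hv).mul
    (hasSpinorClass_reflectionMatrix (hw.trans_ne hv))
  rw [hw, ← sq, ← one_mul ((formVal B v v / 2) ^ 2)] at h
  exact h.of_mul_sq (div_ne_zero hv h2)

lemma hasSpinorClass_siegelMatrix (h2 : (2 : F) ≠ 0) (hB : B.IsSymm) (hf : formVal B f f = 0)
    (hfv : formVal B f v = 0) (he : formVal B e e ≠ 0) (hfe : formVal B f e = 0)
    (hve : formVal B v e = 0) : HasSpinorClass B (siegelMatrix B f v) 1 := by
  by_cases hv : formVal B v v = 0
  · have hfe' : formVal B f (-e) = 0 := by rw [formVal_neg_right, hfe, neg_zero]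
    have hfve : formVal B f (v + e) = 0 := by rw [formVal_add_right, hfv, hfe, add_zero]
    rw [← add_neg_cancel_right v e, ← siegelMatrix_mul h2 hB hf hfve hfe', ← one_mul (1 : F)]
    refine (hasSpinorClass_siegelMatrix_of_anisotropic h2 hB hf hfve ?_).mul
      (hasSpinorClass_siegelMatrix_of_anisotropic h2 hB hf hfe' ?_)
    · simpa [formVal_add_right, formVal_add_left, hv, hve, formVal_comm hB e v] using he
    · simpa [formVal_neg_left, formVal_neg_right] using he
  · exact hasSpinorClass_siegelMatrix_of_anisotropic h2 hB hf hfv hv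

end Siegel

section TwistedBasis

variable {F : Type*} [Field F] {m : ℕ}

/-- The index `-a` for a hyperbolic index `a`; the indices `1` and `-1` are fixed. The form pairs
the basis vector `e_a` with `e_(dualIdx a)` only. -/
def dualIdx : TwIdx m → TwIdx m := Sum.map id Sum.swap

/-- The nonzero entry in row `a` of the matrix of the form. -/
def formWeight (ε : F) : TwIdx m → F := Sum.elim ![1, ε] 1

@[simp] lemma dualIdx_inl (a : Fin 2) : dualIdx (Sum.inl a : TwIdx m) = Sum.inl a := rfl

@[simp] lemma dualIdx_inr (p : Fin m ⊕ Fin m) : dualIdx (Sum.inr p) = Sum.inr p.swap := rfl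

@[simp] lemma dualIdx_dualIdx (a : TwIdx m) : dualIdx (dualIdx a) = a := by
  rcases a with a | p <;> simp

lemma dualIdx_eq_iff {a b : TwIdx m} : dualIdx a = b ↔ a = dualIdx b :=
  ⟨fun h => by rw [← h, dualIdx_dualIdx], fun h => by rw [h, dualIdx_dualIdx]⟩

@[simp] lemma formWeight_inr (ε : F) (p : Fin m ⊕ Fin m) : formWeight ε (Sum.inr p) = 1 := rfl

lemma formWeight_dualIdx (ε : F) (a : TwIdx m) : formWeight ε (dualIdx a) = formWeight ε a := by
  rcases a with _ | _ <;> rfl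

lemma formWeight_ne_zero {ε : F} (hε : ε ≠ 0) (a : TwIdx m) : formWeight ε a ≠ 0 := by
  rcases a with a | _
  · fin_cases a <;> simp [formWeight, hε]
  · simp

lemma twistedForm_apply (ε : F) (a b : TwIdx m) :
    twistedForm ε m a b = if b = dualIdx a then formWeight ε a else 0 := by
  rcases a with a | i | i <;> rcases b with b | j | j <;> try fin_cases a
  all_goals try fin_cases b
  all_goals simp [twistedForm, formWeight, one_apply, eq_comm]

lemma twistedForm_isSymm (ε : F) (m : ℕ) : (twistedForm ε m).IsSymm := by
  refine IsSymm.ext fun a b => ?_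
  simp only [twistedForm_apply, eq_comm (a := a), dualIdx_eq_iff]
  split_ifs with h
  · rw [h, formWeight_dualIdx]
  · rfl

lemma single_vecMul_twistedForm (ε : F) (a : TwIdx m) :
    Pi.single a 1 ᵥ* twistedForm ε m = Pi.single (dualIdx a) (formWeight ε a) := by
  ext b
  simp [Pi.single_apply, twistedForm_apply]

lemma formVal_single_left (ε : F) (a : TwIdx m) (x : TwIdx m → F) :
    formVal (twistedForm ε m) (Pi.single a 1) x = formWeight ε a * x (dualIdx a) := by
  rw [formVal, dotProduct_mulVec, single_vecMul_twistedForm, single_dotProduct]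

lemma formVal_single_right (ε : F) (a : TwIdx m) (x : TwIdx m → F) :
    formVal (twistedForm ε m) x (Pi.single a 1) = formWeight ε a * x (dualIdx a) := by
  rw [formVal_comm (twistedForm_isSymm ε m), formVal_single_left]

lemma formVal_single_inr_self (ε : F) (p : Fin m ⊕ Fin m) :
    formVal (twistedForm ε m) (Pi.single (Sum.inr p) 1) (Pi.single (Sum.inr p) 1) = 0 := by
  rcases p with i | i <;> simp [formVal_single_left]

end TwistedBasis

section Elementary

variable {F : Type*} [Field F] {m : ℕ} {ε : F}

lemma siegelMatrix_single (ε : F) (p : Fin m ⊕ Fin m) (k : TwIdx m) (r : F) :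
    siegelMatrix (twistedForm ε m) (Pi.single (Sum.inr p) 1) (r • Pi.single k 1) =
      1 + r • (matUnit k (Sum.inr p.swap) - formWeight ε k • matUnit (Sum.inr p) (dualIdx k))
        - (r ^ 2 * (if dualIdx k = k then formWeight ε k else 0) / 2) •
          matUnit (Sum.inr p) (Sum.inr p.swap) := by
  have hk : (Pi.single (dualIdx k) (formWeight ε k) : TwIdx m → F) =
      formWeight ε k • Pi.single (dualIdx k) 1 := by simp [← Pi.single_smul]
  rw [siegelMatrix, formVal_smul_left, formVal_smul_right, formVal_single_left, smul_vecMul,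
    single_vecMul_twistedForm, single_vecMul_twistedForm, hk, Pi.single_apply, formWeight_inr,
    dualIdx_inr]
  simp only [matUnit, single_eq_single_vecMulVec_single, vecMulVec_smul, smul_vecMulVec]
  split_ifs <;> module

lemma siegelMatrix_single_inl (ε : F) (p : Fin m ⊕ Fin m) (a : Fin 2) (r : F) :
    siegelMatrix (twistedForm ε m) (Pi.single (Sum.inr p) 1) (r • Pi.single (Sum.inl a) 1) =
      1 + r • (matUnit (Sum.inl a) (Sum.inr p.swap) -
          (![1, ε] a) • matUnit (Sum.inr p) (Sum.inl a))
        - (![1, ε] a * r ^ 2 / 2) • matUnit (Sum.inr p) (Sum.inr p.swap) := by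
  rw [siegelMatrix_single, dualIdx_inl, if_pos rfl, formWeight, Sum.elim_inl, mul_comm (r ^ 2)]

lemma siegelMatrix_single_inr (ε : F) (p q : Fin m ⊕ Fin m) (r : F) :
    siegelMatrix (twistedForm ε m) (Pi.single (Sum.inr p) 1) (r • Pi.single (Sum.inr q) 1) =
      1 + r • (matUnit (Sum.inr q) (Sum.inr p.swap) - matUnit (Sum.inr p) (Sum.inr q.swap)) := by
  have hq : dualIdx (Sum.inr q : TwIdx m) ≠ Sum.inr q := by rcases q with j | j <;> simp
  rw [siegelMatrix_single, if_neg hq, dualIdx_inr, formWeight_inr, one_smul, mul_zero, zero_div,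
    zero_smul, sub_zero]

lemma isElementary_siegelMatrix_inl (ε : F) (p : Fin m ⊕ Fin m) (a : Fin 2) (r : F) :
    IsElementary ε
      (siegelMatrix (twistedForm ε m) (Pi.single (Sum.inr p) 1) (r • Pi.single (Sum.inl a) 1)) := by
  rw [siegelMatrix_single_inl]
  rcases p with i | i <;> fin_cases a
  · convert IsElementary.one_pos (ε := ε) i (-r) using 1
    simp only [Fin.zero_eta, cons_val_zero, Sum.swap_inl]
    module
  · convert IsElementary.negOne_pos (ε := ε) i (-r) using 1
    simp only [Fin.mk_one, cons_val_one, cons_val_zero, Sum.swap_inl]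
    module
  · convert IsElementary.pos_one (ε := ε) i r using 1
    simp only [Fin.zero_eta, cons_val_zero, Sum.swap_inr, one_smul, one_mul]
  · exact IsElementary.pos_negOne i r

lemma isElementary_siegelMatrix_inr (ε : F) {p q : Fin m ⊕ Fin m} (hqp : q ≠ p)
    (hqp' : q ≠ p.swap) (r : F) : IsElementary ε
      (siegelMatrix (twistedForm ε m) (Pi.single (Sum.inr p) 1) (r • Pi.single (Sum.inr q) 1)) := by
  rw [siegelMatrix_single_inr]
  rcases p with i | i <;> rcases q with j | j
  · rcases lt_or_gt_of_ne (show j ≠ i by simpa using hqp) with h | h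
    · exact IsElementary.pos_neg j i h r
    · convert IsElementary.pos_neg (ε := ε) i j h (-r) using 1
      simp only [Sum.swap_inl]
      module
  · convert IsElementary.pos_pos (ε := ε) i j (by simpa [eq_comm] using hqp') (-r) using 1
    simp only [Sum.swap_inl, Sum.swap_inr]
    module
  · exact IsElementary.pos_pos j i (by simpa using hqp') r
  · rcases lt_or_gt_of_ne (show j ≠ i by simpa using hqp) with h | h
    · exact IsElementary.neg_pos j i h r
    · convert IsElementary.neg_pos (ε := ε) i j h (-r) using 1
      simp only [Sum.swap_inr]
      module

lemma formVal_single_inr_smul_single (ε : F) {p : Fin m ⊕ Fin m} {k : TwIdx m}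
    (hk : k ≠ Sum.inr p.swap) (r : F) :
    formVal (twistedForm ε m) (Pi.single (Sum.inr p) 1) (r • Pi.single k 1) = 0 := by
  simp [formVal_smul_right, formVal_single_left, hk.symm]

lemma hasSpinorClass_siegelMatrix_single (h2 : (2 : F) ≠ 0) (hε : ε ≠ 0) {p : Fin m ⊕ Fin m}
    {k : TwIdx m} (hk : k ≠ Sum.inr p.swap) (r : F) : HasSpinorClass (twistedForm ε m)
      (siegelMatrix (twistedForm ε m) (Pi.single (Sum.inr p) 1) (r • Pi.single k 1)) 1 := by
  obtain ⟨a, hka⟩ : ∃ a : Fin 2, k ≠ Sum.inl a := by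
    rcases k with a | q
    · exact ⟨a + 1, by simp⟩
    · exact ⟨0, by simp⟩
  refine hasSpinorClass_siegelMatrix (e := Pi.single (Sum.inl a) 1) h2 (twistedForm_isSymm ε m)
    (formVal_single_inr_self ε p) (formVal_single_inr_smul_single ε hk r) ?_ ?_ ?_
  · simp [formVal_single_left, formWeight_ne_zero hε]
  · simp [formVal_single_left]
  · simp [formVal_smul_left, formVal_single_right, hka.symm]

namespace IsElementary

variable {x : Matrix (TwIdx m) (TwIdx m) F}

lemma exists_eq_siegelMatrix (hx : IsElementary ε x) :
    ∃ (p : Fin m ⊕ Fin m) (k : TwIdx m) (r : F), k ≠ Sum.inr p.swap ∧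
      x = siegelMatrix (twistedForm ε m) (Pi.single (Sum.inr p) 1) (r • Pi.single k 1) := by
  rcases hx with ⟨i, j, hij, t⟩ | ⟨i, j, hij, t⟩ | ⟨i, j, hij, t⟩ | ⟨i, t⟩ | ⟨i, t⟩ |
    ⟨i, t⟩ | ⟨i, t⟩
  · exact ⟨Sum.inr j, idxPos i, t, by simpa using hij,
      (siegelMatrix_single_inr ε (Sum.inr j) (Sum.inl i) t).symm⟩
  · exact ⟨Sum.inl j, idxPos i, t, by simp,
      (siegelMatrix_single_inr ε (Sum.inl j) (Sum.inl i) t).symm⟩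
  · exact ⟨Sum.inr j, idxNeg i, t, by simp,
      (siegelMatrix_single_inr ε (Sum.inr j) (Sum.inr i) t).symm⟩
  · refine ⟨Sum.inr i, idxOne m, t, by simp, ?_⟩
    rw [siegelMatrix_single_inl, cons_val_zero, one_smul, one_mul, Sum.swap_inr]
  · refine ⟨Sum.inl i, idxOne m, -t, by simp, ?_⟩
    rw [siegelMatrix_single_inl, cons_val_zero, Sum.swap_inl]
    module
  · exact ⟨Sum.inr i, idxNegOne m, t, by simp, (siegelMatrix_single_inl ε (Sum.inr i) 1 t).symm⟩
  · refine ⟨Sum.inl i, idxNegOne m, -t, by simp, ?_⟩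
    rw [siegelMatrix_single_inl, cons_val_one, cons_val_zero, Sum.swap_inl]
    module

lemma hasSpinorClass (h2 : (2 : F) ≠ 0) (hε : ε ≠ 0) (hx : IsElementary ε x) :
    HasSpinorClass (twistedForm ε m) x 1 := by
  obtain ⟨p, k, r, hk, rfl⟩ := hx.exists_eq_siegelMatrix
  exact hasSpinorClass_siegelMatrix_single h2 hε hk r

lemma det_eq_one (h2 : (2 : F) ≠ 0) (hε : ε ≠ 0) (hx : IsElementary ε x) : x.det = 1 := by
  obtain ⟨p, k, r, hk, rfl⟩ := hx.exists_eq_siegelMatrix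
  have hr : r • (Pi.single k 1 : TwIdx m → F) =
      (r / 2) • Pi.single k 1 + (r / 2) • Pi.single k 1 := by
    rw [← add_smul, ← mul_two, div_mul_cancel₀ r h2]
  have horth : formVal (twistedForm ε m) (Pi.single (Sum.inr p) 1) ((r / 2) • Pi.single k 1) = 0 :=
    formVal_single_inr_smul_single ε hk _
  rw [hr, ← siegelMatrix_mul h2 (twistedForm_isSymm ε m) (formVal_single_inr_self ε p) horth horth,
    det_mul, ← sq]
  exact (hasSpinorClass_siegelMatrix_single h2 hε hk (r / 2)).det_sq

end IsElementary

end Elementary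

section Hyperbolic

variable {F : Type*} [Field F] {k : Type*} [DecidableEq k]

lemma diagonal_mulSingle (i : k) (c : F) :
    diagonal (Pi.mulSingle i c) = 1 - single i i 1 + single i i c := by
  ext a b
  rcases eq_or_ne a b with rfl | hab
  · by_cases ha : a = i <;> simp [ha, eq_comm (a := i)]
  · have hi (d : F) : single i i d a b = 0 :=
      single_apply_of_ne _ _ _ _ _ fun h => hab (h.1.symm.trans h.2)
    simp [hab, hi]

variable [Fintype k]

lemma formVal_hyperbolic_single (i : k) (c : F) :
    formVal (fromBlocks 0 1 1 0) (Sum.elim (Pi.single i 1) (Pi.single i c))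
      (Sum.elim (Pi.single i 1) (Pi.single i c)) = 2 * c := by
  simp [formVal, fromBlocks_mulVec, two_mul]

lemma reflectionMatrix_hyperbolic (h2 : (2 : F) ≠ 0) (i : k) {c : F} (hc : c ≠ 0) :
    reflectionMatrix (fromBlocks 0 1 1 0) (Sum.elim (Pi.single i 1) (Pi.single i c)) =
      fromBlocks (1 - single i i 1) (-single i i c⁻¹) (-single i i c) (1 - single i i 1) := by
  rw [reflectionMatrix, formVal_hyperbolic_single, vecMul_fromBlocks]
  ext (a | a) (b | b) <;> by_cases ha : a = i <;> by_cases hb : b = i <;>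
    simp [vecMulVec_apply, one_apply, ha, hb, eq_comm (a := i)]
  all_goals field_simp
  all_goals ring

lemma hasSpinorClass_hyperbolic_reflection (h2 : (2 : F) ≠ 0) (i : k) {c : F} (hc : c ≠ 0) :
    HasSpinorClass (fromBlocks 0 1 1 0)
      (reflectionMatrix (fromBlocks 0 1 1 0) (Sum.elim (Pi.single i 1) (Pi.single i c))) c := by
  have hval := formVal_hyperbolic_single i c
  have h := hasSpinorClass_reflectionMatrix (hval.trans_ne (mul_ne_zero h2 hc))
  rwa [hval, mul_div_cancel_left₀ c h2] at h

lemma hasSpinorClass_hyperbolic_diagonal (h2 : (2 : F) ≠ 0) (i : k) {c : F} (hc : c ≠ 0) :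
    HasSpinorClass (fromBlocks 0 1 1 0)
      (fromBlocks (diagonal (Pi.mulSingle i c)) 0 0 (diagonal (Pi.mulSingle i c⁻¹))) c := by
  have h := (hasSpinorClass_hyperbolic_reflection h2 i one_ne_zero).mul
    (hasSpinorClass_hyperbolic_reflection h2 i hc)
  rw [one_mul, reflectionMatrix_hyperbolic h2 i one_ne_zero,
    reflectionMatrix_hyperbolic h2 i hc, fromBlocks_multiply] at h
  convert h using 2 <;>
    simp [diagonal_mulSingle, Matrix.sub_mul, Matrix.mul_sub, add_comm]

end Hyperbolic

section ElemW

variable {F : Type*} [Field F] {m : ℕ}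

lemma elemW_eq_fromBlocks (h2 : (2 : F) ≠ 0) (i : Fin m) :
    elemW i = fromBlocks 1 0 0 (reflectionMatrix (fromBlocks 0 1 1 0)
      (Sum.elim (Pi.single i (1 : F)) (Pi.single i 1))) := by
  rw [reflectionMatrix_hyperbolic h2 i one_ne_zero, inv_one]
  ext (a | a) (b | b)
  · simp [elemW, matUnit, one_apply]
  · simp [elemW, matUnit]
  · simp [elemW, matUnit]
  · rcases a with a | a <;> rcases b with b | b <;> simp [elemW, matUnit, single_apply, one_apply]

lemma hasSpinorClass_elemW (h2 : (2 : F) ≠ 0) (ε : F) (i : Fin m) :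
    HasSpinorClass (twistedForm ε m) (elemW i) 1 := by
  have h := hasSpinorClass_fromBlocks (hasSpinorClass_one !![1, 0; 0, ε])
    (hasSpinorClass_hyperbolic_reflection h2 i one_ne_zero)
  rwa [one_mul, ← elemW_eq_fromBlocks h2] at h

lemma det_elemW (h2 : (2 : F) ≠ 0) (i : Fin m) : (elemW i : Matrix _ _ F).det = -1 := by
  rw [elemW_eq_fromBlocks h2, det_fromBlocks_zero₂₁, det_one, one_mul, det_reflectionMatrix]
  simpa [formVal_hyperbolic_single] using h2

end ElemW

section Reduces

variable {F : Type*} [Field F] {m : ℕ} {ε : F} {g h : Matrix (TwIdx m) (TwIdx m) F} {N : ℕ}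

namespace Reduces

lemma det_eq (h2 : (2 : F) ≠ 0) (hε : ε ≠ 0) (hr : Reduces ε g N h) :
    h.det = (-1) ^ N * g.det := by
  induction hr with
  | refl => simp
  | row _ hx ih => rw [det_mul, hx.det_eq_one h2 hε, one_mul, ih]
  | col _ hx ih => rw [det_mul, hx.det_eq_one h2 hε, mul_one, ih]
  | rowW _ i ih => rw [det_mul, det_elemW h2, ih]; ring
  | colW _ i ih => rw [det_mul, det_elemW h2, ih]; ring

lemma hasSpinorClass (h2 : (2 : F) ≠ 0) (hε : ε ≠ 0) (hr : Reduces ε g N h) {c : F}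
    (hh : HasSpinorClass (twistedForm ε m) h c) : HasSpinorClass (twistedForm ε m) g c := by
  induction hr with
  | refl => exact hh
  | row _ hx ih => exact ih (by simpa using (hx.hasSpinorClass h2 hε).of_mul_left hh)
  | col _ hx ih => exact ih (by simpa using (hx.hasSpinorClass h2 hε).of_mul_right hh)
  | rowW _ i ih => exact ih (by simpa using (hasSpinorClass_elemW h2 ε i).of_mul_left hh)
  | colW _ i ih => exact ih (by simpa using (hasSpinorClass_elemW h2 ε i).of_mul_right hh)

lemma mem_isometrySubmonoid (h2 : (2 : F) ≠ 0) (hε : ε ≠ 0) (hr : Reduces ε g N h)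
    (hg : g ∈ isometrySubmonoid (twistedForm ε m)) :
    h ∈ isometrySubmonoid (twistedForm ε m) := by
  have hB := twistedForm_isSymm ε m
  induction hr with
  | refl => exact hg
  | row _ hx ih => exact mul_mem ((hx.hasSpinorClass h2 hε).mem_isometrySubmonoid hB) ih
  | col _ hx ih => exact mul_mem ih ((hx.hasSpinorClass h2 hε).mem_isometrySubmonoid hB)
  | rowW _ i ih => exact mul_mem ((hasSpinorClass_elemW h2 ε i).mem_isometrySubmonoid hB) ih
  | colW _ i ih => exact mul_mem ih ((hasSpinorClass_elemW h2 ε i).mem_isometrySubmonoid hB)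

end Reduces

end Reduces

section Elimination

variable {F : Type*} [Field F] {m : ℕ}

/-- The monoid generated by the unipotent elementary matrices. -/
def elementarySubmonoid (ε : F) (m : ℕ) : Submonoid (Matrix (TwIdx m) (TwIdx m) F) :=
  Submonoid.closure {x | IsElementary ε x}

/-- The monoid of matrices fixing the hyperbolic basis vectors `e_b`, `b ∈ S`. -/
def basisFixingSubmonoid (F : Type*) [Field F] (S : Set (Fin m ⊕ Fin m)) :
    Submonoid (Matrix (TwIdx m) (TwIdx m) F) where
  carrier := {a | ∀ b ∈ S, a *ᵥ Pi.single (Sum.inr b) 1 = Pi.single (Sum.inr b) 1}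
  one_mem' b _ := one_mulVec _
  mul_mem' ha hb p hp := by rw [← mulVec_mulVec, hb p hp, ha p hp]

/-- The orthogonal complement of the hyperbolic basis vectors `e_b`, `b ∈ S`. -/
def orthogonalTo (F : Type*) [Field F] (S : Set (Fin m ⊕ Fin m)) : Submodule F (TwIdx m → F) where
  carrier := {x | ∀ b ∈ S, x (Sum.inr b.swap) = 0}
  zero_mem' b _ := rfl
  add_mem' hx hy b hb := by rw [Pi.add_apply, hx b hb, hy b hb, add_zero]
  smul_mem' c x hx b hb := by rw [Pi.smul_apply, hx b hb, smul_zero]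

variable {ε : F} {S : Set (Fin m ⊕ Fin m)} {p q : Fin m ⊕ Fin m} {x v : TwIdx m → F}
  {h : Matrix (TwIdx m) (TwIdx m) F}

lemma Reduces.mul_left {a g : Matrix (TwIdx m) (TwIdx m) F} {N : ℕ}
    (ha : a ∈ elementarySubmonoid ε m) (hr : Reduces ε g N h) : Reduces ε g N (a * h) := by
  induction ha using Submonoid.closure_induction generalizing h with
  | mem x hx => exact .row hr hx
  | one => simpa using hr
  | mul x y _ _ hx hy => rw [mul_assoc]; exact hx (hy hr)

lemma elementarySubmonoid_le_isometrySubmonoid (h2 : (2 : F) ≠ 0) (hε : ε ≠ 0) :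
    elementarySubmonoid ε m ≤ isometrySubmonoid (twistedForm ε m) :=
  Submonoid.closure_le.2 fun _ hx =>
    (IsElementary.hasSpinorClass h2 hε hx).mem_isometrySubmonoid (twistedForm_isSymm ε m)

lemma siegelMatrix_single_mulVec (ε : F) (p : Fin m ⊕ Fin m) (v x : TwIdx m → F) :
    siegelMatrix (twistedForm ε m) (Pi.single (Sum.inr p) 1) v *ᵥ x =
      x + x (Sum.inr p.swap) • v - (formVal (twistedForm ε m) v x +
        formVal (twistedForm ε m) v v / 2 * x (Sum.inr p.swap)) • Pi.single (Sum.inr p) 1 := by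
  rw [siegelMatrix_mulVec, formVal_single_left, formWeight_inr, one_mul, dualIdx_inr]
  module

lemma single_mem_orthogonalTo {k : TwIdx m} (hk : ∀ b ∈ S, Sum.inr b.swap ≠ k) :
    Pi.single k 1 ∈ orthogonalTo F S :=
  fun b hb => Pi.single_eq_of_ne (hk b hb) 1

lemma mulVec_mem_orthogonalTo (hh : h ∈ isometrySubmonoid (twistedForm ε m))
    (hS : h ∈ basisFixingSubmonoid F S) (hx : x ∈ orthogonalTo F S) :
    h *ᵥ x ∈ orthogonalTo F S := by
  intro b hb
  have h1 := hh (Pi.single (Sum.inr b) 1) x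
  rw [hS b hb, formVal_single_left, formVal_single_left] at h1
  simpa [hx b hb] using h1

lemma siegelMatrix_smul_single_mem_elementarySubmonoid (ε : F) {k : TwIdx m}
    (hk : k ≠ Sum.inr p) (hk' : k ≠ Sum.inr p.swap) (r : F) :
    siegelMatrix (twistedForm ε m) (Pi.single (Sum.inr p) 1) (r • Pi.single k 1) ∈
      elementarySubmonoid ε m := by
  refine Submonoid.subset_closure ?_
  rcases k with a | q
  · exact isElementary_siegelMatrix_inl ε p a r
  · exact isElementary_siegelMatrix_inr ε (by simpa using hk) (by simpa using hk') r

lemma siegelMatrix_mem_elementarySubmonoid (h2 : (2 : F) ≠ 0) (ε : F) (hp : v (Sum.inr p) = 0)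
    (hp' : v (Sum.inr p.swap) = 0) :
    siegelMatrix (twistedForm ε m) (Pi.single (Sum.inr p) 1) v ∈ elementarySubmonoid ε m := by
  let A : AddSubmonoid (TwIdx m → F) :=
    { carrier := {w | formVal (twistedForm ε m) (Pi.single (Sum.inr p) 1) w = 0 ∧
        siegelMatrix (twistedForm ε m) (Pi.single (Sum.inr p) 1) w ∈ elementarySubmonoid ε m}
      zero_mem' := ⟨by simp [formVal], by rw [siegelMatrix_zero]; exact one_mem _⟩
      add_mem' := fun ⟨hu, hu'⟩ ⟨hw, hw'⟩ => ⟨by rw [formVal_add_right, hu, hw, add_zero], by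
        rw [← siegelMatrix_mul h2 (twistedForm_isSymm ε m) (formVal_single_inr_self ε p) hu hw]
        exact mul_mem hu' hw'⟩ }
  suffices h : v ∈ A from h.2
  rw [pi_eq_sum_univ' v]
  refine sum_mem fun k _ => ?_
  by_cases hk : k = Sum.inr p ∨ k = Sum.inr p.swap
  · have hvk : v k = 0 := by rcases hk with rfl | rfl <;> assumption
    rw [hvk, zero_smul]
    exact zero_mem _
  · rw [not_or] at hk
    exact ⟨formVal_single_inr_smul_single ε hk.2 _,
      siegelMatrix_smul_single_mem_elementarySubmonoid ε hk.1 hk.2 _⟩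

lemma siegelMatrix_mem_basisFixingSubmonoid (hv : v ∈ orthogonalTo F S) (hp : p.swap ∉ S) :
    siegelMatrix (twistedForm ε m) (Pi.single (Sum.inr p) 1) v ∈ basisFixingSubmonoid F S := by
  intro b hb
  have hpb : (Pi.single (Sum.inr b) 1 : TwIdx m → F) (Sum.inr p.swap) = 0 :=
    Pi.single_eq_of_ne (fun h => hp (by rwa [Sum.inr_injective h])) 1
  rw [siegelMatrix_single_mulVec, hpb, formVal_single_right, dualIdx_inr, hv b hb]
  simp

lemma formVal_single_add_single_swap (ε : F) (p : Fin m ⊕ Fin m) (c d : F) :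
    formVal (twistedForm ε m) (c • Pi.single (Sum.inr p) 1 + d • Pi.single (Sum.inr p.swap) 1)
      (c • Pi.single (Sum.inr p) 1 + d • Pi.single (Sum.inr p.swap) 1) = 2 * c * d := by
  have hpp : p.swap ≠ p := by rcases p with i | i <;> simp
  simp only [formVal_add_left, formVal_smul_left, formVal_single_left, formWeight_inr, dualIdx_inr,
    Sum.swap_swap, Pi.add_apply, Pi.smul_apply, smul_eq_mul, Pi.single_eq_same,
    Pi.single_eq_of_ne (Sum.inr_injective.ne hpp),
    Pi.single_eq_of_ne (Sum.inr_injective.ne hpp.symm)]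
  ring

/-- The Siegel transformation along `e_p` clears every coordinate of `x` but those at `p` and `-p`;
the coordinate at `p` of the result vanishes because the result is isotropic. -/
lemma exists_mulVec_eq_smul_single_swap (h2 : (2 : F) ≠ 0) (hε : ε ≠ 0) (hp : p.swap ∉ S)
    (hx : x ∈ orthogonalTo F S) (hx0 : formVal (twistedForm ε m) x x = 0)
    (hxp : x (Sum.inr p.swap) ≠ 0) :
    ∃ a ∈ elementarySubmonoid ε m ⊓ basisFixingSubmonoid F (insert p S),
      a *ᵥ x = x (Sum.inr p.swap) • Pi.single (Sum.inr p.swap) 1 := by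
  have hpp : p.swap ≠ p := by rcases p with i | i <;> simp
  set k : TwIdx m := Sum.inr p with hk
  set k' : TwIdx m := Sum.inr p.swap with hk'
  have hkk : k' ≠ k := by simpa [hk, hk'] using hpp
  let w : TwIdx m → F := Function.update (Function.update x k 0) k' 0
  have hxw : x = w + x k • Pi.single k 1 + x k' • Pi.single k' 1 := by
    ext j
    by_cases hj : j = k <;> by_cases hj' : j = k' <;> simp_all [w]
  have hwk : w k = 0 := by simp [w, hkk.symm]
  have hwk' : w k' = 0 := by simp [w]
  have hwS : w ∈ orthogonalTo F (insert p S) := by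
    rintro b (rfl | hb)
    · exact hwk'
    · simp [w, Function.update_apply, hx b hb]
  let a := siegelMatrix (twistedForm ε m) (Pi.single k 1) (-(x k')⁻¹ • w)
  have ha : a ∈ elementarySubmonoid ε m :=
    siegelMatrix_mem_elementarySubmonoid h2 ε (by simp [← hk, hwk]) (by simp [← hk', hwk'])
  have haS : a ∈ basisFixingSubmonoid F (insert p S) :=
    siegelMatrix_mem_basisFixingSubmonoid (Submodule.smul_mem _ _ hwS) (by simp [hpp, hp])
  obtain ⟨d, hd⟩ : ∃ d : F, a *ᵥ x = x - w - d • Pi.single k 1 := by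
    have hxw' : x k' • -(x k')⁻¹ • w = -w := by
      rw [smul_smul, mul_neg, mul_inv_cancel₀ hxp, neg_one_smul]
    simp only [a, hk, siegelMatrix_single_mulVec, ← hk', hxw', ← sub_eq_add_neg, sub_right_inj]
    exact exists_apply_eq_apply' (fun d : F => d • (Pi.single k 1 : TwIdx m → F)) _
  have hax : a *ᵥ x = (x k - d) • Pi.single k 1 + x k' • Pi.single k' 1 := by
    rw [hd]
    linear_combination (norm := module) hxw
  have hd0 : x k - d = 0 := by
    have hiso := elementarySubmonoid_le_isometrySubmonoid h2 hε ha x x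
    rw [hax, hx0, formVal_single_add_single_swap] at hiso
    simpa [h2, hxp] using hiso
  exact ⟨a, ⟨ha, haS⟩, by rw [hax, hd0, zero_smul, zero_add]⟩

lemma siegelMatrix_smul_single_mulVec_apply (ε : F) {k : TwIdx m} (hk : k ≠ Sum.inr p)
    (hx : x (Sum.inr p) = 0) (r : F) :
    (siegelMatrix (twistedForm ε m) (Pi.single (Sum.inr p) 1) (r • Pi.single k 1) *ᵥ x)
      (Sum.inr p) = -(r * formWeight ε k * x (dualIdx k) +
        r ^ 2 * formVal (twistedForm ε m) (Pi.single k 1) (Pi.single k 1) / 2 *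
          x (Sum.inr p.swap)) := by
  rw [siegelMatrix_single_mulVec]
  simp only [formVal_smul_left, formVal_smul_right, formVal_single_left, Pi.add_apply,
    Pi.sub_apply, Pi.smul_apply, smul_eq_mul, hx, Pi.single_eq_same, Pi.single_eq_of_ne hk.symm]
  ring

lemma exists_mulVec_apply_ne_zero (h2 : (2 : F) ≠ 0) (hε : ε ≠ 0) (hS : ∀ b ∈ S, b.swap ∈ S)
    (hp : p.swap ∉ S) (hx : x ∈ orthogonalTo F S) (hne : x ≠ 0) :
    ∃ a ∈ elementarySubmonoid ε m ⊓ basisFixingSubmonoid F S, (a *ᵥ x) (Sum.inr p) ≠ 0 := by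
  by_cases hxp : x (Sum.inr p) = 0
  swap
  · exact ⟨1, one_mem _, by rwa [one_mulVec]⟩
  obtain ⟨k, r, hk, hk', hkS, hne⟩ : ∃ (k : TwIdx m) (r : F), k ≠ Sum.inr p ∧ k ≠ Sum.inr p.swap ∧
      (∀ b ∈ S, Sum.inr b.swap ≠ k) ∧ r * formWeight ε k * x (dualIdx k) +
        r ^ 2 * formVal (twistedForm ε m) (Pi.single k 1) (Pi.single k 1) / 2 *
          x (Sum.inr p.swap) ≠ 0 := by
    by_cases hxp' : x (Sum.inr p.swap) = 0
    · obtain ⟨j, hj⟩ := Function.ne_iff.1 hne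
      refine ⟨dualIdx j, 1, ?_, ?_, fun b hb h => hj ?_, ?_⟩
      · rintro h
        exact hj (by rwa [dualIdx_eq_iff.1 h])
      · rintro h
        exact hj (by rwa [dualIdx_eq_iff.1 h, dualIdx_inr, Sum.swap_swap])
      · rw [← dualIdx_eq_iff.2 h, dualIdx_inr]
        exact hx _ (hS b hb)
      · simpa [hxp', formWeight_ne_zero hε] using hj
    · obtain ⟨r, hr⟩ : ∃ r : F, r * x (idxOne m) + r ^ 2 / 2 * x (Sum.inr p.swap) ≠ 0 := by
        by_contra! h
        exact hxp' (by linear_combination h 1 + h (-1) - x (Sum.inr p.swap) * mul_inv_cancel₀ h2)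
      refine ⟨idxOne m, r, by simp, by simp, by simp, ?_⟩
      simpa [formVal_single_left, formWeight] using hr
  refine ⟨_, ⟨siegelMatrix_smul_single_mem_elementarySubmonoid ε hk hk' r,
    siegelMatrix_mem_basisFixingSubmonoid
      (Submodule.smul_mem _ _ (single_mem_orthogonalTo hkS)) hp⟩, ?_⟩
  rw [siegelMatrix_smul_single_mulVec_apply ε hk hxp]
  exact neg_ne_zero.2 hne

lemma exists_mulVec_eq_smul_single (h2 : (2 : F) ≠ 0) (hε : ε ≠ 0) (hS : ∀ b ∈ S, b.swap ∈ S)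
    (hp : p ∉ S) (hx : x ∈ orthogonalTo F S) (hx0 : formVal (twistedForm ε m) x x = 0)
    (hne : x ≠ 0) :
    ∃ a ∈ elementarySubmonoid ε m ⊓ basisFixingSubmonoid F S, ∃ c : Fˣ,
      a *ᵥ x = (c : F) • Pi.single (Sum.inr p) 1 := by
  have hp' : p.swap ∉ S := fun h => hp (by simpa using hS _ h)
  obtain ⟨a, ha, hax⟩ := exists_mulVec_apply_ne_zero h2 hε hS hp' hx hne
  have ha' := elementarySubmonoid_le_isometrySubmonoid h2 hε ha.1
  obtain ⟨b, hb, hbx⟩ := exists_mulVec_eq_smul_single_swap (p := p.swap) h2 hε (by simpa using hp)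
    (mulVec_mem_orthogonalTo ha' ha.2 hx) (by rw [ha', hx0]) (by simpa using hax)
  refine ⟨b * a, mul_mem ⟨hb.1, fun c hc => hb.2 c (Set.mem_insert_of_mem _ hc)⟩ ha,
    Units.mk0 _ hax, ?_⟩
  rw [← mulVec_mulVec, hbx, Sum.swap_swap, Units.val_mk0]

lemma exists_mulVec_smul_add_smul_single (hqp : q ≠ p) (hqp' : q ≠ p.swap) (hp : p.swap ∉ S)
    (hq : q ∉ S) (ε c c' : F) {d : F} (hd : d ≠ 0) :
    ∃ a ∈ elementarySubmonoid ε m ⊓ basisFixingSubmonoid F S,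
      a *ᵥ (c • Pi.single (Sum.inr p) 1 + d • Pi.single (Sum.inr q) 1) =
        c' • Pi.single (Sum.inr p) 1 + d • Pi.single (Sum.inr q) 1 := by
  have hqp'' : q.swap ≠ p := fun h => hqp' (by rw [← h, Sum.swap_swap])
  have hqp''' : q.swap ≠ p.swap := fun h => hqp (Sum.swap_leftInverse.injective h)
  have hpp : p.swap ≠ p := by rcases p with i | i <;> simp
  refine ⟨siegelMatrix (twistedForm ε m) (Pi.single (Sum.inr p) 1)
    (((c - c') / d) • Pi.single (Sum.inr q.swap) 1),
    ⟨siegelMatrix_smul_single_mem_elementarySubmonoid ε (by simpa using hqp'')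
      (by simpa using hqp''') _, siegelMatrix_mem_basisFixingSubmonoid
      (Submodule.smul_mem _ _ (single_mem_orthogonalTo fun b hb h => hq ?_)) hp⟩, ?_⟩
  · rwa [← Sum.swap_leftInverse.injective (Sum.inr_injective h)]
  · rw [siegelMatrix_single_mulVec]
    simp only [formVal_smul_left, formVal_single_left, formWeight_inr, dualIdx_inr, Sum.swap_swap,
      Pi.add_apply, Pi.smul_apply, smul_eq_mul, Pi.single_eq_same,
      Pi.single_eq_of_ne (Sum.inr_injective.ne hqp'.symm),
      Pi.single_eq_of_ne (Sum.inr_injective.ne hpp),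
      Pi.single_eq_of_ne (Sum.inr_injective.ne hqp)]
    match_scalars <;> field_simp <;> ring

lemma exists_mulVec_smul_single_eq_single (hqp : q ≠ p) (hqp' : q ≠ p.swap)
    (hp : p ∉ S) (hp' : p.swap ∉ S) (hq : q ∉ S) (hq' : q.swap ∉ S) (ε : F) {c : F} (hc : c ≠ 0) :
    ∃ a ∈ elementarySubmonoid ε m ⊓ basisFixingSubmonoid F S,
      a *ᵥ (c • Pi.single (Sum.inr p) 1) = Pi.single (Sum.inr p) 1 := by
  have hpq' : p ≠ q.swap := fun h => hqp' (by rw [h, Sum.swap_swap])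
  obtain ⟨a₁, ha₁, h₁⟩ := exists_mulVec_smul_add_smul_single hqp.symm hpq' hq' hp ε 0 1 hc
  obtain ⟨a₂, ha₂, h₂⟩ := exists_mulVec_smul_add_smul_single hqp hqp' hp' hq ε c 1 one_ne_zero
  obtain ⟨a₃, ha₃, h₃⟩ :=
    exists_mulVec_smul_add_smul_single hqp.symm hpq' hq' hp ε 1 0 one_ne_zero
  refine ⟨a₃ * (a₂ * a₁), mul_mem ha₃ (mul_mem ha₂ ha₁), ?_⟩
  rw [zero_smul, zero_add, add_comm] at h₁
  rw [add_comm, zero_smul, zero_add] at h₃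
  rw [← mulVec_mulVec, ← mulVec_mulVec, h₁, h₂, h₃, one_smul]

lemma mulVec_single_ne_zero (hε : ε ≠ 0) (hh : h ∈ isometrySubmonoid (twistedForm ε m))
    (k : TwIdx m) : h *ᵥ Pi.single k 1 ≠ 0 := by
  intro h0
  have h1 := hh (Pi.single k 1) (Pi.single (dualIdx k) 1)
  rw [h0, formVal_single_left, Pi.single_eq_same, mul_one] at h1
  exact formWeight_ne_zero hε k (by rw [← h1, formVal, zero_dotProduct])

lemma exists_mul_mulVec_single_eq_smul (h2 : (2 : F) ≠ 0) (hε : ε ≠ 0)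
    (hS : ∀ b ∈ S, b.swap ∈ S) (hp : p ∉ S) (hh : h ∈ isometrySubmonoid (twistedForm ε m))
    (hhS : h ∈ basisFixingSubmonoid F S) :
    ∃ a ∈ elementarySubmonoid ε m ⊓ basisFixingSubmonoid F S, ∃ c : Fˣ,
      (a * h) *ᵥ Pi.single (Sum.inr p) 1 = (c : F) • Pi.single (Sum.inr p) 1 := by
  have hpS : Pi.single (Sum.inr p) 1 ∈ orthogonalTo F S := single_mem_orthogonalTo fun b hb hbp =>
    hp (Sum.inr_injective hbp ▸ hS b hb)
  simp only [← mulVec_mulVec]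
  exact exists_mulVec_eq_smul_single h2 hε hS hp (mulVec_mem_orthogonalTo hh hhS hpS)
    (by rw [hh, formVal_single_inr_self]) (mulVec_single_ne_zero hε hh _)

lemma mem_basisFixingSubmonoid_insert :
    h ∈ basisFixingSubmonoid F (insert p S) ↔
      h *ᵥ Pi.single (Sum.inr p) 1 = Pi.single (Sum.inr p) 1 ∧ h ∈ basisFixingSubmonoid F S :=
  Set.forall_mem_insert

lemma exists_mul_mem_basisFixingSubmonoid_insert_swap (h2 : (2 : F) ≠ 0) (hε : ε ≠ 0)
    (hp : p ∉ S) (hp' : p.swap ∉ S) (hh : h ∈ isometrySubmonoid (twistedForm ε m))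
    (hhS : h ∈ basisFixingSubmonoid F (insert p S)) :
    ∃ a ∈ elementarySubmonoid ε m,
      a * h ∈ basisFixingSubmonoid F (insert p.swap (insert p S)) := by
  have hpS : Pi.single (Sum.inr p.swap) 1 ∈ orthogonalTo F S := single_mem_orthogonalTo
    fun b hb hbp => hp (by rwa [← Sum.swap_leftInverse.injective (Sum.inr_injective hbp)])
  have hx1 : (h *ᵥ Pi.single (Sum.inr p.swap) 1) (Sum.inr p.swap) = 1 := by
    have h1 := hh (Pi.single (Sum.inr p) 1) (Pi.single (Sum.inr p.swap) 1)
    rwa [hhS p (Set.mem_insert _ _), formVal_single_left, formVal_single_left, formWeight_inr,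
      dualIdx_inr, one_mul, one_mul, Pi.single_eq_same] at h1
  obtain ⟨a, ⟨ha, haS⟩, hax⟩ := exists_mulVec_eq_smul_single_swap h2 hε hp'
    (mulVec_mem_orthogonalTo hh (mem_basisFixingSubmonoid_insert.1 hhS).2 hpS)
    (by rw [hh, formVal_single_inr_self]) (by rw [hx1]; exact one_ne_zero)
  refine ⟨a, ha, mem_basisFixingSubmonoid_insert.2 ⟨?_, mul_mem haS hhS⟩⟩
  rw [← mulVec_mulVec, hax, hx1, one_smul]

/-- A second hyperbolic pair `e_q`, `e_(-q)` is used to normalise the scalar by which `e_p` is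
multiplied; this is why the last pair has to be treated separately. -/
lemma exists_mul_mem_basisFixingSubmonoid_insert_insert (h2 : (2 : F) ≠ 0) (hε : ε ≠ 0)
    (hS : ∀ b ∈ S, b.swap ∈ S) (hqp : q ≠ p) (hqp' : q ≠ p.swap) (hp : p ∉ S) (hq : q ∉ S)
    (hh : h ∈ isometrySubmonoid (twistedForm ε m)) (hhS : h ∈ basisFixingSubmonoid F S) :
    ∃ a ∈ elementarySubmonoid ε m,
      a * h ∈ basisFixingSubmonoid F (insert p.swap (insert p S)) := by
  have hp' : p.swap ∉ S := fun h => hp (by simpa using hS _ h)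
  have hq' : q.swap ∉ S := fun h => hq (by simpa using hS _ h)
  obtain ⟨a, ha, c, hc⟩ := exists_mul_mulVec_single_eq_smul h2 hε hS hp hh hhS
  obtain ⟨b, hb, hbc⟩ := exists_mulVec_smul_single_eq_single hqp hqp' hp hp' hq hq' ε c.ne_zero
  have hba := mul_mem hb ha
  obtain ⟨d, hd, hdh⟩ := exists_mul_mem_basisFixingSubmonoid_insert_swap h2 hε hp hp'
    (mul_mem (elementarySubmonoid_le_isometrySubmonoid h2 hε hba.1) hh)
    (mem_basisFixingSubmonoid_insert.2
      ⟨by rw [mul_assoc, ← mulVec_mulVec, hc, hbc], mul_mem hba.2 hhS⟩)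
  exact ⟨d * (b * a), mul_mem hd hba.1, by rwa [mul_assoc]⟩

lemma exists_mul_mem_basisFixingSubmonoid (h2 : (2 : F) ≠ 0) (hε : ε ≠ 0) {l : Fin m}
    (hh : h ∈ isometrySubmonoid (twistedForm ε m)) (J : Finset (Fin m)) (hl : l ∉ J) :
    ∃ a ∈ elementarySubmonoid ε m,
      a * h ∈ basisFixingSubmonoid F {b | Sum.elim id id b ∈ J} := by
  induction J using Finset.induction_on with
  | empty => exact ⟨1, one_mem _, fun b hb => by simp at hb⟩
  | insert j J hj ih =>
    rw [Finset.mem_insert, not_or] at hl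
    obtain ⟨a, ha, hah⟩ := ih hl.2
    obtain ⟨b, hb, hbh⟩ := exists_mul_mem_basisFixingSubmonoid_insert_insert (p := Sum.inl j)
      (q := Sum.inl l) h2 hε (by rintro (b | b) <;> exact id) (by simpa using hl.1) (by simp)
      (by simpa using hj) (by simpa using hl.2)
      (mul_mem (elementarySubmonoid_le_isometrySubmonoid h2 hε ha) hh) hah
    refine ⟨b * a, mul_mem hb ha, fun k hk => ?_⟩
    rw [mul_assoc]
    refine hbh k ?_
    rcases k with k | k <;> simpa using hk

end Elimination

section Output

variable {F : Type*} [Field F] {m : ℕ}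

lemma lastDiag_mul (m : ℕ) (c d : F) : lastDiag m c * lastDiag m d = lastDiag m (c * d) := by
  rw [lastDiag, lastDiag, lastDiag, diagonal_mul_diagonal]
  exact congrArg diagonal (funext fun i => by split_ifs <;> simp)

lemma lastDiag_one (m : ℕ) : lastDiag m (1 : F) = 1 := by simp [lastDiag]

lemma lastDiag_succ (m : ℕ) (c : F) :
    lastDiag (m + 1) c = diagonal (Pi.mulSingle (Fin.last m) c) := by
  rw [lastDiag]
  exact congrArg diagonal (funext fun i => by simp [Pi.mulSingle_apply, Fin.ext_iff])

lemma outputMatrix_mul (A C : Matrix (Fin 2) (Fin 2) F) (c d : Fˣ) :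
    (outputMatrix A c * outputMatrix C d : Matrix (TwIdx m) (TwIdx m) F) =
      outputMatrix (A * C) (c * d) := by
  simp [outputMatrix, fromBlocks_multiply, lastDiag_mul, mul_comm]

lemma outputMatrix_one_one : (outputMatrix 1 1 : Matrix (TwIdx m) (TwIdx m) F) = 1 := by
  simp [outputMatrix, lastDiag_one]

lemma det_outputMatrix (A : Matrix (Fin 2) (Fin 2) F) (c : Fˣ) :
    (outputMatrix A c : Matrix (TwIdx m) (TwIdx m) F).det = A.det := by
  rw [outputMatrix, det_fromBlocks_zero₂₁, det_fromBlocks_zero₂₁, ← det_mul, lastDiag_mul,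
    ← Units.val_mul, mul_inv_cancel, Units.val_one, lastDiag_one, det_one, mul_one]

lemma hasSpinorClass_outputMatrix (h2 : (2 : F) ≠ 0) {ε c : F} {A : Matrix (Fin 2) (Fin 2) F}
    {lam : Fˣ} (hA : HasSpinorClass !![1, 0; 0, ε] A c) (hlam : m = 0 → lam = 1) :
    HasSpinorClass (twistedForm ε m) (outputMatrix A lam) (c * lam) := by
  refine hasSpinorClass_fromBlocks hA ?_
  rcases m with _ | m
  · rw [hlam rfl, inv_one, Units.val_one, lastDiag_one, fromBlocks_one]
    exact hasSpinorClass_one _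
  · rw [lastDiag_succ, lastDiag_succ, Units.val_inv_eq_inv_val]
    exact hasSpinorClass_hyperbolic_diagonal h2 (Fin.last m) lam.ne_zero

lemma mem_isometrySubmonoid_of_outputMatrix {ε : F} {A : Matrix (Fin 2) (Fin 2) F} {lam : Fˣ}
    (h : outputMatrix A lam ∈ isometrySubmonoid (twistedForm ε m)) :
    A ∈ isometrySubmonoid !![1, 0; 0, ε] := by
  rw [← transpose_mul_mul_eq_iff_mem_isometrySubmonoid] at h ⊢
  simpa [outputMatrix, twistedForm, fromBlocks_transpose, fromBlocks_multiply] using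
    congrArg toBlocks₁₁ h

end Output

section ExistsOutput

variable {F : Type*} [Field F] {m : ℕ} {ε : F} {h : Matrix (TwIdx m) (TwIdx m) F}

lemma outputMatrix_mulVec_single (A : Matrix (Fin 2) (Fin 2) F) (c : Fˣ)
    (p : Fin (m + 1) ⊕ Fin (m + 1)) :
    outputMatrix A c *ᵥ (Pi.single (Sum.inr p) 1 : TwIdx (m + 1) → F) =
      (Sum.elim (Pi.mulSingle (Fin.last m) (c : F)) (Pi.mulSingle (Fin.last m) (c⁻¹ : F)) p) •
        Pi.single (Sum.inr p) 1 := by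
  rw [outputMatrix, lastDiag_succ, lastDiag_succ, fromBlocks_diagonal, Units.val_inv_eq_inv_val,
    mulVec_single_one, ← Pi.single_smul, smul_eq_mul, mul_one]
  ext (a | q)
  · simp
  · rcases eq_or_ne q p with rfl | hqp
    · simp
    · simp [hqp]

lemma exists_eq_outputMatrix_one (hh : h ∈ isometrySubmonoid (twistedForm ε m))
    (hfix : h ∈ basisFixingSubmonoid F Set.univ) :
    ∃ A : Matrix (Fin 2) (Fin 2) F, h = outputMatrix A 1 := by
  have hcol (k : TwIdx m) (p : Fin m ⊕ Fin m) :
      h k (Sum.inr p) = (Pi.single (Sum.inr p) 1 : TwIdx m → F) k := by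
    rw [← hfix p trivial, mulVec_single_one, col_apply]
  have hrow (p : Fin m ⊕ Fin m) (a : Fin 2) : h (Sum.inr p) (Sum.inl a) = 0 := by
    have ha : Pi.single (Sum.inl a) 1 ∈ orthogonalTo F (Set.univ : Set (Fin m ⊕ Fin m)) :=
      single_mem_orthogonalTo (by simp)
    simpa using mulVec_mem_orthogonalTo hh hfix ha p.swap trivial
  refine ⟨h.toBlocks₁₁, ?_⟩
  rw [outputMatrix, inv_one, Units.val_one, lastDiag_one, fromBlocks_one]
  ext (a | p) (b | q)
  · rfl
  · simp [hcol]
  · simp [hrow]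
  · simp [hcol, Pi.single_apply, one_apply]

lemma exists_mul_mulVec_single_last_eq_smul (h2 : (2 : F) ≠ 0) (hε : ε ≠ 0)
    {h : Matrix (TwIdx (m + 1)) (TwIdx (m + 1)) F}
    (hh : h ∈ isometrySubmonoid (twistedForm ε (m + 1))) :
    ∃ a ∈ elementarySubmonoid ε (m + 1),
      a * h ∈ basisFixingSubmonoid F {b | Sum.elim id id b ≠ Fin.last m} ∧ ∃ c : Fˣ,
        (a * h) *ᵥ Pi.single (idxPos (Fin.last m)) 1 =
          (c : F) • Pi.single (idxPos (Fin.last m)) 1 := by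
  obtain ⟨a, ha, haS⟩ :=
    exists_mul_mem_basisFixingSubmonoid (l := Fin.last m) h2 hε hh {Fin.last m}ᶜ (by simp)
  simp only [Finset.mem_compl, Finset.mem_singleton] at haS
  obtain ⟨b, ⟨hb, hbS⟩, c, hc⟩ := exists_mul_mulVec_single_eq_smul (p := Sum.inl (Fin.last m))
    h2 hε (by rintro (b | b) <;> exact id) (by simp)
    (mul_mem (elementarySubmonoid_le_isometrySubmonoid h2 hε ha) hh) haS
  rw [← mul_assoc] at hc
  exact ⟨b * a, mul_mem hb ha, by rw [mul_assoc]; exact mul_mem hbS haS, c, hc⟩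

lemma exists_mul_eq_outputMatrix (h2 : (2 : F) ≠ 0) (hε : ε ≠ 0)
    {h : Matrix (TwIdx (m + 1)) (TwIdx (m + 1)) F}
    (hh : h ∈ isometrySubmonoid (twistedForm ε (m + 1))) :
    ∃ a ∈ elementarySubmonoid ε (m + 1), ∃ (A : Matrix (Fin 2) (Fin 2) F) (c : Fˣ),
      a * h = outputMatrix A c := by
  obtain ⟨a, ha, haS, c, hc⟩ := exists_mul_mulVec_single_last_eq_smul h2 hε hh
  have hd : outputMatrix 1 c⁻¹ ∈ isometrySubmonoid (twistedForm ε (m + 1)) :=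
    (hasSpinorClass_outputMatrix h2 (hasSpinorClass_one _) (by simp)).mem_isometrySubmonoid
      (twistedForm_isSymm ε _)
  have hle := elementarySubmonoid_le_isometrySubmonoid (m := m + 1) h2 hε
  have hiso : a * h * outputMatrix 1 c⁻¹ ∈ isometrySubmonoid (twistedForm ε (m + 1)) :=
    mul_mem (mul_mem (hle ha) hh) hd
  have hfix : a * h * outputMatrix 1 c⁻¹ ∈ basisFixingSubmonoid F
      (insert (Sum.inl (Fin.last m)) {b | Sum.elim id id b ≠ Fin.last m}) := by
    refine mem_basisFixingSubmonoid_insert.2 ⟨?_, mul_mem haS fun p hp => ?_⟩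
    · rw [← mulVec_mulVec, outputMatrix_mulVec_single, mulVec_smul, hc, smul_smul]
      simp
    · rw [outputMatrix_mulVec_single]
      rcases p with j | j <;> simp_all
  obtain ⟨b, hb, hbfix⟩ :=
    exists_mul_mem_basisFixingSubmonoid_insert_swap h2 hε (by simp) (by simp) hiso hfix
  obtain ⟨A, hA⟩ := exists_eq_outputMatrix_one (mul_mem (hle hb) hiso) fun p _ =>
    hbfix p (by rcases p with j | j <;> by_cases hj : j = Fin.last m <;> simp [hj])
  refine ⟨b * a, mul_mem hb ha, A, c, ?_⟩
  calc b * a * h = b * (a * h * outputMatrix 1 c⁻¹) * outputMatrix 1 c := by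
        simp [mul_assoc, outputMatrix_mul, outputMatrix_one_one]
    _ = outputMatrix A c := by rw [hA, outputMatrix_mul, mul_one, one_mul]

theorem exists_isGaussianOutput (h2 : (2 : F) ≠ 0) (hε : ε ≠ 0)
    (hh : h ∈ isometrySubmonoid (twistedForm ε m)) :
    ∃ (N : ℕ) (A : Matrix (Fin 2) (Fin 2) F) (lam : Fˣ), IsGaussianOutput ε h N A lam := by
  rcases m with _ | m
  · obtain ⟨A, rfl⟩ := exists_eq_outputMatrix_one hh fun p => isEmptyElim p
    exact ⟨0, A, 1, fun _ => rfl, .refl⟩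
  · obtain ⟨a, ha, A, c, hah⟩ := exists_mul_eq_outputMatrix h2 hε hh
    exact ⟨0, A, c, by simp, hah ▸ Reduces.mul_left ha .refl⟩

end ExistsOutput

section BinaryForm

variable {F : Type*} [Field F] {ε t s : F}

lemma exists_eq_rotation_or_reflection (hε : ε ≠ 0) {A : Matrix (Fin 2) (Fin 2) F}
    (hA : A ∈ isometrySubmonoid !![1, 0; 0, ε]) :
    ∃ t s : F, t ^ 2 + ε * s ^ 2 = 1 ∧ (A = !![t, -(ε * s); s, t] ∨ A = !![t, ε * s; s, -t]) := by
  rw [← transpose_mul_mul_eq_iff_mem_isometrySubmonoid] at hA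
  obtain ⟨a, b, c, d, rfl⟩ : ∃ a b c d : F, A = !![a, b; c, d] := ⟨_, _, _, _, A.eta_fin_two⟩
  have hdet := congrArg det hA
  have h00 := congrFun₂ hA 0 0
  have h01 := congrFun₂ hA 0 1
  simp only [det_mul, det_transpose, det_fin_two_of] at hdet
  simp only [mul_apply, transpose_apply, of_apply, cons_val', cons_val_zero, cons_val_fin_one,
    Fin.sum_univ_two, cons_val_one, mul_one, mul_zero, add_zero, zero_add] at h00 h01
  have hsq : (a * d - b * c) ^ 2 = 1 := mul_left_cancel₀ hε (by linear_combination hdet)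
  have hb : b = -(ε * c * (a * d - b * c)) := by linear_combination a * h01 - b * h00
  have hd : d = a * (a * d - b * c) := by linear_combination c * h01 - d * h00
  refine ⟨a, c, by linear_combination h00, ?_⟩
  rcases sq_eq_one_iff.1 hsq with h | h
  · rw [h, mul_one] at hb hd
    exact .inl (by rw [hb, hd])
  · rw [h, mul_neg_one] at hb hd
    exact .inr (by rw [hb, hd, neg_neg])

lemma formVal_binary (ε : F) (u v : Fin 2 → F) :
    formVal !![1, 0; 0, ε] u v = u 0 * v 0 + ε * u 1 * v 1 := by
  simp [formVal, dotProduct, Fin.sum_univ_two, mulVec, mul_left_comm, mul_assoc]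

lemma hasSpinorClass_reflection (h2 : (2 : F) ≠ 0) (hts : t ^ 2 + ε * s ^ 2 = 1) (ht : t ≠ 1) :
    HasSpinorClass !![1, 0; 0, ε] !![t, ε * s; s, -t] (1 - t) := by
  have ht' : 1 - t ≠ 0 := sub_ne_zero.2 ht.symm
  have hself : formVal !![1, 0; 0, ε] ![t - 1, s] ![t - 1, s] = 2 * (1 - t) := by
    rw [formVal_binary, cons_val_zero, cons_val_one, cons_val_zero]
    linear_combination hts
  have hrefl : reflectionMatrix !![1, 0; 0, ε] ![t - 1, s] = !![t, ε * s; s, -t] := by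
    refine matrix_ext_mulVec fun x => funext (Fin.forall_fin_two.2 ⟨?_, ?_⟩)
    · suffices x 0 - 1 / (1 - t) * ((t - 1) * x 0 + ε * s * x 1) * (t - 1) =
          t * x 0 + ε * s * x 1 by
        simpa [reflectionMatrix_mulVec, hself, formVal_binary, vecHead, vecTail, ← div_div, h2]
      field_simp
      ring
    · suffices x 1 - 1 / (1 - t) * ((t - 1) * x 0 + ε * s * x 1) * s = s * x 0 + -t * x 1 by
        simpa [reflectionMatrix_mulVec, hself, formVal_binary, vecHead, vecTail, ← div_div, h2]
      field_simp
      linear_combination -x 1 * hts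
  have h := hasSpinorClass_reflectionMatrix (hself.trans_ne (mul_ne_zero h2 ht'))
  rwa [hself, hrefl, mul_div_cancel_left₀ _ h2] at h

lemma hasSpinorClass_diag_one_neg_one (h2 : (2 : F) ≠ 0) (hε : ε ≠ 0) :
    HasSpinorClass !![1, 0; 0, ε] !![1, 0; 0, -1] (2 * ε) := by
  have hself : formVal !![1, 0; 0, ε] ![0, 1] ![0, 1] = ε := by simp [formVal_binary]
  have hrefl : reflectionMatrix !![1, 0; 0, ε] ![0, 1] = !![1, 0; 0, -1] := by
    refine matrix_ext_mulVec fun x => funext (Fin.forall_fin_two.2 ⟨?_, ?_⟩)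
    · simp [reflectionMatrix_mulVec, vecHead]
    · suffices x 1 - 2 / ε * (ε * x 1) = -x 1 by
        simpa [reflectionMatrix_mulVec, hself, formVal_binary, vecHead, vecTail]
      field_simp
      ring
  have h := hasSpinorClass_reflectionMatrix (hself.trans_ne hε)
  rw [hself, hrefl] at h
  refine HasSpinorClass.of_mul_sq (x := 2⁻¹) ?_ (inv_ne_zero h2)
  convert h using 1
  field_simp

lemma hasSpinorClass_rotation (h2 : (2 : F) ≠ 0) (hε : ε ≠ 0) (hts : t ^ 2 + ε * s ^ 2 = 1)
    (ht : t ≠ 1) :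
    HasSpinorClass !![1, 0; 0, ε] !![t, -(ε * s); s, t] (2 * ε * (1 - t)) := by
  have h := (hasSpinorClass_reflection h2 hts ht).mul (hasSpinorClass_diag_one_neg_one h2 hε)
  simpa [mul_comm] using h

end BinaryForm

section Main

variable {F : Type*} [Field F] {m N : ℕ} {ε t s : F} {g : Matrix (TwIdx m) (TwIdx m) F}
  {A : Matrix (Fin 2) (Fin 2) F} {lam : Fˣ}

namespace IsGaussianOutput

lemma det_eq (h2 : (2 : F) ≠ 0) (hε : ε ≠ 0) (hout : IsGaussianOutput ε g N A lam) :
    g.det = (-1) ^ N * A.det := by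
  rw [← det_outputMatrix A lam, hout.2.det_eq h2 hε, ← mul_assoc, ← mul_pow, neg_one_mul, neg_neg,
    one_pow, one_mul]

lemma spinorNorm_eq (h2 : (2 : F) ≠ 0) (hε : ε ≠ 0) (hout : IsGaussianOutput ε g N A lam) {c : F}
    (hA : HasSpinorClass !![1, 0; 0, ε] A c) :
    spinorNorm (twistedForm ε m) g = sqCoset (c * lam) :=
  (hout.2.hasSpinorClass h2 hε (hasSpinorClass_outputMatrix h2 hA hout.1)).spinorNorm_eq h2
    (twistedForm_isSymm ε m)

lemma spinorNorm_eq_of_reflection (h2 : (2 : F) ≠ 0) (hε : ε ≠ 0) (hts : t ^ 2 + ε * s ^ 2 = 1)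
    (hout : IsGaussianOutput ε g N !![t, ε * s; s, -t] lam) :
    (t ≠ 1 → spinorNorm (twistedForm ε m) g = sqCoset ((lam : F) * (1 - t))) ∧
      (t = 1 → spinorNorm (twistedForm ε m) g = sqCoset (2 * ε * (lam : F))) := by
  refine ⟨fun ht => ?_, ?_⟩
  · rw [hout.spinorNorm_eq h2 hε (hasSpinorClass_reflection h2 hts ht), mul_comm]
  · rintro rfl
    obtain rfl : s = 0 := by simpa [hε] using hts
    rw [mul_zero] at hout
    exact hout.spinorNorm_eq h2 hε (hasSpinorClass_diag_one_neg_one h2 hε)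

lemma spinorNorm_eq_of_rotation (h2 : (2 : F) ≠ 0) (hε : ε ≠ 0) (hts : t ^ 2 + ε * s ^ 2 = 1)
    (hout : IsGaussianOutput ε g N !![t, -(ε * s); s, t] lam) :
    (t ≠ 1 → spinorNorm (twistedForm ε m) g = sqCoset (2 * ε * (lam : F) * (1 - t))) ∧
      (t = 1 → spinorNorm (twistedForm ε m) g = sqCoset (lam : F)) := by
  refine ⟨fun ht => ?_, ?_⟩
  · rw [hout.spinorNorm_eq h2 hε (hasSpinorClass_rotation h2 hε hts ht), mul_right_comm]
  · rintro rfl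
    obtain rfl : s = 0 := by simpa [hε] using hts
    rw [mul_zero, neg_zero, ← one_fin_two] at hout
    rw [hout.spinorNorm_eq h2 hε (hasSpinorClass_one _), one_mul]

end IsGaussianOutput

lemma neg_one_pow_ne_neg_one_pow_succ (h2 : (2 : F) ≠ 0) (N : ℕ) :
    (-1 : F) ^ N ≠ (-1) ^ (N + 1) := by
  intro h
  rw [pow_succ, mul_neg_one, eq_neg_iff_add_eq_zero, ← two_mul] at h
  simp [h2] at h

lemma two_ne_zero_of_not_isSquare [Finite F] (hε : ¬ IsSquare ε) : (2 : F) ≠ 0 := by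
  intro h2
  have := CharTwo.of_one_ne_zero_of_two_eq_zero one_ne_zero h2
  exact hε (FiniteField.isSquare_of_char_two (ringChar.eq F 2) ε)

end Main

theorem corollaryA2_general {F : Type*} [Field F] (h2 : (2 : F) ≠ 0) {ε : F} (hε : ε ≠ 0) (m : ℕ)
    (g : GL (TwIdx m) F) (hg : g ∈ twistedOrthogonalGroup ε m) :
    (∃ (N : ℕ) (A₀ : Matrix (Fin 2) (Fin 2) F) (lam : Fˣ), IsGaussianOutput ε g.val N A₀ lam) ∧
    ∀ (N : ℕ) (A₀ : Matrix (Fin 2) (Fin 2) F) (lam : Fˣ), IsGaussianOutput ε g.val N A₀ lam →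
      (g.val.det = (-1) ^ N ∨ g.val.det = (-1) ^ (N + 1)) ∧
      ∃ t s : F, t ^ 2 + ε * s ^ 2 = 1 ∧
        (g.val.det = (-1) ^ (N + 1) →
          A₀ = !![t, ε * s; s, -t] ∧
          (t ≠ 1 →
            spinorNorm (twistedForm ε m) g.val = sqCoset ((lam : F) * (1 - t))) ∧
          (t = 1 →
            spinorNorm (twistedForm ε m) g.val = sqCoset (2 * ε * (lam : F)))) ∧
        (g.val.det = (-1) ^ N →
          A₀ = !![t, -(ε * s); s, t] ∧
          (t ≠ 1 →
            spinorNorm (twistedForm ε m) g.val = sqCoset (2 * ε * (lam : F) * (1 - t))) ∧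
          (t = 1 →
            spinorNorm (twistedForm ε m) g.val = sqCoset (lam : F))) := by
  have hiso := transpose_mul_mul_eq_iff_mem_isometrySubmonoid.1 hg
  refine ⟨exists_isGaussianOutput h2 hε hiso, fun N A lam hout => ?_⟩
  have hA := mem_isometrySubmonoid_of_outputMatrix (hout.2.mem_isometrySubmonoid h2 hε hiso)
  obtain ⟨t, s, hts, rfl | rfl⟩ := exists_eq_rotation_or_reflection hε hA
  · have hdet : g.val.det = (-1) ^ N := by
      rw [hout.det_eq h2 hε, det_fin_two_of]
      linear_combination (-1) ^ N * hts
    exact ⟨.inl hdet, t, s, hts,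
      fun h => absurd (hdet.symm.trans h) (neg_one_pow_ne_neg_one_pow_succ h2 N),
      fun _ => ⟨rfl, hout.spinorNorm_eq_of_rotation h2 hε hts⟩⟩
  · have hdet : g.val.det = (-1) ^ (N + 1) := by
      rw [hout.det_eq h2 hε, det_fin_two_of]
      linear_combination (-1) ^ (N + 1) * hts
    exact ⟨.inr hdet, t, s, hts, fun _ => ⟨rfl, hout.spinorNorm_eq_of_reflection h2 hε hts⟩,
      fun h => absurd (h.symm.trans hdet) (neg_one_pow_ne_neg_one_pow_succ h2 N)⟩

theorem corollaryA2 {F : Type*} [Field F] [Finite F] (ε : F) (hε : ¬ IsSquare ε) (m : ℕ)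
    (g : GL (TwIdx m) F) (hg : g ∈ twistedOrthogonalGroup ε m) :
    (∃ (N : ℕ) (A₀ : Matrix (Fin 2) (Fin 2) F) (lam : Fˣ), IsGaussianOutput ε g.val N A₀ lam) ∧
    ∀ (N : ℕ) (A₀ : Matrix (Fin 2) (Fin 2) F) (lam : Fˣ), IsGaussianOutput ε g.val N A₀ lam →
      (g.val.det = (-1) ^ N ∨ g.val.det = (-1) ^ (N + 1)) ∧
      ∃ t s : F, t ^ 2 + ε * s ^ 2 = 1 ∧
        (g.val.det = (-1) ^ (N + 1) →
          A₀ = !![t, ε * s; s, -t] ∧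
          (t ≠ 1 →
            spinorNorm (twistedForm ε m) g.val = sqCoset ((lam : F) * (1 - t))) ∧
          (t = 1 →
            spinorNorm (twistedForm ε m) g.val = sqCoset (2 * ε * (lam : F)))) ∧
        (g.val.det = (-1) ^ N →
          A₀ = !![t, -(ε * s); s, t] ∧
          (t ≠ 1 →
            spinorNorm (twistedForm ε m) g.val = sqCoset (2 * ε * (lam : F) * (1 - t))) ∧
          (t = 1 →
            spinorNorm (twistedForm ε m) g.val = sqCoset (lam : F))) :=
  corollaryA2_general (two_ne_zero_of_not_isSquare hε) (by rintro rfl; exact hε .zero) m g hg
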